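/- Let $\mathfrak g=\mathfrak{sl}(3,\mathbb R)=\bigoplus_{k=-2}^{2}\mathfrak g_k$ with the contact grading $\deg E_{ij}=j-i$, let $\mathfrak g_-=\mathfrak g_{-2}\oplus\mathfrak g_{-1}$, $\mathfrak g^0=\mathfrak g_0\oplus\mathfrak g_1\oplus\mathfrak g_2$, and let $G^0\subset SL(3,\mathbb R)$ be the group of upper triangular matrices. Put $$(A_1,\dots,A_8)=(E_{13},E_{12},E_{23},E_{11}-E_{22},E_{22}-E_{33},E_{32},E_{21},E_{31}),$$ $e_0=A_8,\ e_1=A_7,\ e_2=A_6$, $\check e_0=A_1,\ \check e_1=A_2,\ \check e_2=A_3$, let $A_i^*$ be the dual basis, and $e_0^*=A_8^*$, $e_1^*=A_7^*$, $e_2^*=A_6^*$; the last three form a basis of $\mathfrak g_-^*=(\mathfrak g/\mathfrak g^0)^*$. Let $V=\mathfrak g$ with its Killing form $\kappa$, let $\mathfrak l=\mathfrak o(V,\kappa)\cong\mathfrak o(5,3)$ with the induced grading, identify $\mathfrak g$ with $\operatorname{ad}\mathfrak g\subset\mathfrak l$, and let $\mathfrak g^\perp$ be the orthogonal complement of $\mathfrak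 g$ in $\mathfrak l$ for the trace form. As a $\mathfrak g$-module, $\mathfrak g^\perp=\Gamma_{3,0}\oplus\Gamma_{0,3}$, where $\Gamma_{3,0}$ has the basis $$R_{2,1}=A_1\otimes A_7^*-A_2\otimes A_8^*,\quad R_{1,1}=[e_1,R_{2,1}],\ R_{1,0}=[e_2,R_{1,1}],\ R_{0,1}=[e_1,R_{1,1}],\ R_{0,0}=[e_2,R_{0,1}],\ R_{0,-1}=[e_2,R_{0,0}],$$ $$R_{-1,1}=[e_1,R_{0,1}],\ R_{-1,0}=[e_2,R_{-1,1}],\ R_{-1,-1}=[e_2,R_{-1,0}],\ R_{-1,-2}=[e_2,R_{-1,-1}],$$ and $\Gamma_{0,3}$ has the basis $$S_{1,2}=A_1\otimes A_6^*-A_3\otimes A_8^*,\quad S_{1,1}=[e_2,S_{1,2}],\ S_{0,1}=[e_1,S_{1,1}],\ S_{1,0}=[e_2,S_{1,1}],\ S_{0,0}=[e_1,S_{1,0}],\ S_{-1,0}=[e_1,S_{0,0}],$$ $$S_{1,-1}=[e_2,S_{1,0}],\ S_{0,-1}=[e_1,S_{1,-1}],\ S_{-1,-1}=[e_1,S_{0,-1}],\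 S_{-2,-1}=[e_1,S_{-1,-1}].$$ Put $\xi^R_1=R_{-1,1}\otimes e_2^*$ and $\xi^S_1=S_{1,-1}\otimes e_1^*$ in $\operatorname{Hom}(\mathfrak g_-,\mathfrak g^\perp)=\operatorname{Hom}(\mathfrak g/\mathfrak g^0,\mathfrak g^\perp)$, on which $x\in\mathfrak g^0$ acts by $(\rho(x)f)(y)=[x,f(y)]-f([x,y])$. An extrinsic Cartan connection of $\mathfrak{sl}_3$ type is a pair $(P,\omega)$, where $P$ is a principal $G^0$-bundle over a smooth $3$-manifold $M$ and $\omega$ is a smooth $\mathfrak l$-valued $1$-form on $P$ such that: $\omega(\tilde A)=A$ for the fundamental vector field $\tilde A$ of every $A\in\mathfrak g^0$; $R_a^*\omega=\operatorname{Ad}(a^{-1})\omega$ for $a\in G^0$ (hence $L_{\tilde A}\omega=-\operatorname{ad}(A)\omega$); $d\omega+\tfrac12[\omega,\omega]=0$; and, writing $\omega=\omega_I+\omega_{II}$ according to $\mathfrak l=\mathfrak g\oplus\mathfrak g^\perp$, the map $\omega_I\colon T_zP\to\mathfrak g$ is an isomorphism for every $z\in P$. Its structure function $\chi$ is defined by $\omega_{II}=\chi\,\omega_I$;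 it vanishes on $\mathfrak g^0$ and so takes values in $\operatorname{Hom}(\mathfrak g_-,\mathfrak g^\perp)$. Let $\chi_p$ be its component of degree $p$ (mapping $\mathfrak g_q$ to $\mathfrak g^\perp_{p+q}$), and $\chi_p=\chi_p^R+\chi_p^S$ the decomposition according to $\mathfrak g^\perp=\Gamma_{3,0}\oplus\Gamma_{0,3}$. The connection is normal if $\partial^*\chi=0$, where $\partial^*f=\sum_{i=0}^{2}[\check e_i,f(e_i)]$, and $\chi_p=0$ for $p\le 0$. For $x\in\mathfrak g$ and a smooth function $f$ on $P$, let $D_xf$ be the derivative of $f$ along the vector field $\omega_I^{-1}(x)$. **Proposition.** Let $(P,\omega)$ be a normal extrinsic Cartan connection of $\mathfrak{sl}_3$ type. Then $\chi=\sum_{p=1}^5(\chi_p^R+\chi_p^S)$, and there are smooth functions $h_1^R,h_1^S\colon P\to\mathbb R$ such that $$\begin{aligned} \chi_1^R&=h_1^R\,R_{-1,1}\otimes e_2^*=h_1^R\,\xi_1^R,\\ \chi_2^R&=D_{e_1}h_1^R\big(-\tfrac34R_{0,1}\otimes e_2^*-\tfrac14R_{-1,1}\otimes e_0^*\big)=-\tfrac14D_{e_1}h_1^R\,\rho(\check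 e_1)\xi_1^R,\\ \chi_3^R&=D_{e_1}^2h_1^R\big(\tfrac12R_{1,1}\otimes e_2^*+\tfrac14R_{0,1}\otimes e_0^*\big)=\tfrac1{24}D_{e_1}^2h_1^R\,\rho(\check e_1)^2\xi_1^R,\\ \chi_4^R&=D_{e_1}^3h_1^R\big(-\tfrac14R_{2,1}\otimes e_2^*-\tfrac14R_{1,1}\otimes e_0^*\big)=-\tfrac1{36\cdot4}D_{e_1}^3h_1^R\,\rho(\check e_1)^3\xi_1^R,\\ \chi_5^R&=D_{e_1}^4h_1^R\big(\tfrac14R_{2,1}\otimes e_0^*\big)=\tfrac1{36\cdot4\cdot4}D_{e_1}^4h_1^R\,\rho(\check e_1)^4\xi_1^R, \end{aligned}$$ and $$\begin{aligned} \chi_1^S&=h_1^S\,S_{1,-1}\otimes e_1^*=h_1^S\,\xi_1^S,\\ \chi_2^S&=D_{e_2}h_1^S\big(-\tfrac34S_{1,0}\otimes e_1^*+\tfrac14S_{1,-1}\otimes e_0^*\big)=-\tfrac14D_{e_2}h_1^S\,\rho(\check e_2)\xi_1^S,\\ \chi_3^S&=D_{e_2}^2h_1^S\big(\tfrac12S_{1,1}\otimes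 e_1^*-\tfrac14S_{1,0}\otimes e_0^*\big)=\tfrac1{24}D_{e_2}^2h_1^S\,\rho(\check e_2)^2\xi_1^S,\\ \chi_4^S&=D_{e_2}^3h_1^S\big(-\tfrac14S_{1,2}\otimes e_1^*+\tfrac14S_{1,1}\otimes e_0^*\big)=-\tfrac1{36\cdot4}D_{e_2}^3h_1^S\,\rho(\check e_2)^3\xi_1^S,\\ \chi_5^S&=D_{e_2}^4h_1^S\big(-\tfrac14S_{1,2}\otimes e_0^*\big)=\tfrac1{36\cdot4\cdot4}D_{e_2}^4h_1^S\,\rho(\check e_2)^4\xi_1^S. \end{aligned}$$ -/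

import Mathlib

open scoped Manifold ContDiff

noncomputable section

namespace SL3

attribute [local instance 100] LieRing.ofAssociativeRing

attribute [local instance 100] LieRing.ofAssociativeRing

/-! ### The Lie algebra `𝔤 = 𝔰𝔩(3,ℝ)` and its adjoint representation by `8 × 8` matrices -/

/-- `𝔤 = 𝔰𝔩(3,ℝ)`. -/
abbrev g := LieAlgebra.SpecialLinear.sl (Fin 3) ℝ

/-- Real `8 × 8` matrices, i.e. `𝔤𝔩(V)` for `V = 𝔰𝔩(3,ℝ)` with the basis `A₁, …, A₈`. -/
abbrev Mat8 := Matrix (Fin 8) (Fin 8) ℝ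

/-- The matrix unit `E_{ij}`, `i ≠ j`, as an element of `𝔤`. -/
def E (i j : Fin 3) (h : i ≠ j) : g := LieAlgebra.SpecialLinear.single i j h 1

/-- The basis `A₁, …, A₈` of `𝔤` (indexed from `0`):
`E₁₃, E₁₂, E₂₃, E₁₁ - E₂₂, E₂₂ - E₃₃, E₃₂, E₂₁, E₃₁`. -/
def A : Fin 8 → Matrix (Fin 3) (Fin 3) ℝ :=
  ![!![0, 0, 1; 0, 0, 0; 0, 0, 0], !![0, 1, 0; 0, 0, 0; 0, 0, 0], !![0, 0, 0; 0, 0, 1; 0, 0, 0],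
    !![1, 0, 0; 0, -1, 0; 0, 0, 0], !![0, 0, 0; 0, 1, 0; 0, 0, -1],
    !![0, 0, 0; 0, 0, 0; 0, 1, 0], !![0, 0, 0; 1, 0, 0; 0, 0, 0], !![0, 0, 0; 0, 0, 0; 1, 0, 0]]

/-- The coordinates of a traceless matrix in the basis `A₁, …, A₈`. -/
def coords (X : Matrix (Fin 3) (Fin 3) ℝ) : Fin 8 → ℝ :=
  ![X 0 2, X 0 1, X 1 2, X 0 0, X 0 0 + X 1 1, X 2 1, X 1 0, X 2 0]

lemma sum_coords_smul_A (X : g) : ∑ k, coords X.1 k • A k = X.1 := by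
  have h : X.1 0 0 + X.1 1 1 + X.1 2 2 = 0 := by
    have h := LinearMap.mem_ker.1 X.2
    simpa [Matrix.trace, Fin.sum_univ_succ, add_assoc] using h
  ext i j
  fin_cases i <;> fin_cases j <;>
    simp [A, coords, Fin.sum_univ_succ]
  linarith

/-- The matrix of the endomorphism `Y ↦ [X, Y]` of `V = 𝔰𝔩(3,ℝ)` in the basis `A₁, …, A₈`
(for any `3 × 3` matrix `X`; scalar matrices are sent to `0`). -/
def ad (X : Matrix (Fin 3) (Fin 3) ℝ) : Mat8 :=
  Matrix.of fun i j => coords (X * A j - A j * X) i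

/-- The matrix of the endomorphism `Y ↦ a Y a⁻¹` of `V = 𝔰𝔩(3,ℝ)` in the basis `A₁, …, A₈`. -/
def Ad (a : Matrix.SpecialLinearGroup (Fin 3) ℝ) : Mat8 :=
  Matrix.of fun i j => coords (a.1 * A j * (a⁻¹).1) i

/-- The Gram matrix of the Killing form `κ(X, Y) = tr (ad X ad Y)` of `V = 𝔰𝔩(3,ℝ)`. -/
def kappa : Mat8 := Matrix.of fun i j => (ad (A i) * ad (A j)).trace

/-- `𝔩 = 𝔬(V, κ) ≅ 𝔬(5,3)`: matrices `X` with `Xᵀ κ + κ X = 0`. -/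
def l : LieSubalgebra ℝ Mat8 := skewAdjointMatricesLieSubalgebra kappa

/-- The elements `e₀ = E₃₁`, `e₁ = E₂₁`, `e₂ = E₃₂`, a basis of `𝔤₋`. -/
def e : Fin 3 → g :=
  ![E 2 0 (by decide), E 1 0 (by decide), E 2 1 (by decide)]

/-- The elements `ě₀ = E₁₃`, `ě₁ = E₁₂`, `ě₂ = E₂₃`, a basis of `𝔤₊`, dual to `e₀, e₁, e₂`
with respect to the trace form. -/
def eCheck : Fin 3 → g :=
  ![E 0 2 (by decide), E 0 1 (by decide), E 1 2 (by decide)]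

/-- The linear forms `e₀*, e₁*, e₂*` on `𝔤`: members of the dual basis of `A₁, …, A₈`. They vanish
on `𝔤⁰`, and so form the basis of `𝔤₋*` dual to `e₀, e₁, e₂`. -/
def eStar (i : Fin 3) : g →ₗ[ℝ] ℝ :=
  (Matrix.entryLinearMap ℝ ℝ (![2, 1, 2] i : Fin 3) (![0, 0, 1] i : Fin 3)).comp
    (LieAlgebra.SpecialLinear.sl (Fin 3) ℝ).toSubmodule.subtype

lemma eStar_e (i j : Fin 3) : eStar i (e j) = if i = j then 1 else 0 := by
  have h : eStar i (e j) = (e j).1 (![2, 1, 2] i) (![0, 0, 1] i) := rfl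
  rw [h]
  fin_cases i <;> fin_cases j <;> simp [e, E]

/-! ### The weight vectors of `Γ_{3,0}` and `Γ_{0,3}` -/

/-- `A_i ⊗ A_j*` (with `i`, `j` counted from `0`). -/
def unit8 (i j : Fin 8) : Mat8 := Matrix.single i j 1

/-- Bracket with `ad e_i`. -/
def brE (i : Fin 3) (X : Mat8) : Mat8 := ⁅ad (e i).1, X⁆

def R_2_1 : Mat8 := unit8 0 6 - unit8 1 7
def R_1_1 : Mat8 := brE 1 R_2_1
def R_1_0 : Mat8 := brE 2 R_1_1
def R_0_1 : Mat8 := brE 1 R_1_1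
def R_0_0 : Mat8 := brE 2 R_0_1
def R_0_m1 : Mat8 := brE 2 R_0_0
def R_m1_1 : Mat8 := brE 1 R_0_1
def R_m1_0 : Mat8 := brE 2 R_m1_1
def R_m1_m1 : Mat8 := brE 2 R_m1_0
def R_m1_m2 : Mat8 := brE 2 R_m1_m1

def S_1_2 : Mat8 := unit8 0 5 - unit8 2 7
def S_1_1 : Mat8 := brE 2 S_1_2
def S_0_1 : Mat8 := brE 1 S_1_1
def S_1_0 : Mat8 := brE 2 S_1_1
def S_0_0 : Mat8 := brE 1 S_1_0
def S_m1_0 : Mat8 := brE 1 S_0_0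
def S_1_m1 : Mat8 := brE 2 S_1_0
def S_0_m1 : Mat8 := brE 1 S_1_m1
def S_m1_m1 : Mat8 := brE 1 S_0_m1
def S_m2_m1 : Mat8 := brE 1 S_m1_m1

/-- The weight vectors `R_{i,j}`, a basis of `Γ_{3,0}`. -/
def R : Fin 10 → Mat8 :=
  ![R_2_1, R_1_1, R_1_0, R_0_1, R_0_0, R_0_m1, R_m1_1, R_m1_0, R_m1_m1, R_m1_m2]

/-- The weight vectors `S_{i,j}`, a basis of `Γ_{0,3}`, listed so that `R k` and `S k` have opposite
weights. -/
def S : Fin 10 → Mat8 :=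
  ![S_m2_m1, S_m1_m1, S_m1_0, S_0_m1, S_0_0, S_0_1, S_1_m1, S_1_0, S_1_1, S_1_2]

/-- The projection of `𝔩 = 𝔤 ⊕ Γ_{3,0} ⊕ Γ_{0,3}` onto `Γ_{3,0}`, written through the trace form,
for which `R` and `S` are dual up to scalars (see `projR_R`, `projR_S`, `projR_ad`). -/
def projR : Mat8 →ₗ[ℝ] Mat8 :=
  ∑ k, ((R k * S k).trace)⁻¹ •
    ((Matrix.traceLinearMap (Fin 8) ℝ ℝ).comp (LinearMap.mulRight ℝ (S k))).smulRight (R k)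

/-- The projection of `𝔩 = 𝔤 ⊕ Γ_{3,0} ⊕ Γ_{0,3}` onto `Γ_{0,3}`
(see `projS_R`, `projS_S`, `projS_ad`). -/
def projS : Mat8 →ₗ[ℝ] Mat8 :=
  ∑ k, ((R k * S k).trace)⁻¹ •
    ((Matrix.traceLinearMap (Fin 8) ℝ ℝ).comp (LinearMap.mulRight ℝ (R k))).smulRight (S k)

/-! ### Checks that `projR` and `projS` are the projections of `𝔤 ⊕ Γ_{3,0} ⊕ Γ_{0,3}` -/

/-- Integral matrices, viewed as real ones. -/
def cst (X : Matrix (Fin 8) (Fin 8) ℤ) : Mat8 := X.map (Int.castRingHom ℝ)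

lemma cst_mul (X Y : Matrix (Fin 8) (Fin 8) ℤ) : cst X * cst Y = cst (X * Y) :=
  (Matrix.map_mul (f := Int.castRingHom ℝ)).symm

lemma cst_sub (X Y : Matrix (Fin 8) (Fin 8) ℤ) : cst X - cst Y = cst (X - Y) := by
  ext i j
  simp [cst]

lemma cst_trace (X : Matrix (Fin 8) (Fin 8) ℤ) : (cst X).trace = (X.trace : ℝ) := by
  simp [cst, Matrix.trace]

def eZ : Fin 3 → Matrix (Fin 8) (Fin 8) ℤ :=
  ![0,
    !![0, 0, 0, 0, 0, 0, 0, 0; 0, 0, 0, 0, 0, 0, 0, 0; 1, 0, 0, 0, 0, 0, 0, 0; 0, -1, 0, 0, 0, 0, 0, 0; 0, 0, 0, 0, 0, 0, 0, 0; 0, 0, 0, 0, 0, 0, 0, 0; 0, 0, 0, 2, -1, 0, 0, 0; 0, 0, 0, 0, 0, -1, 0, 0],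
    !![0, 0, 0, 0, 0, 0, 0, 0; -1, 0, 0, 0, 0, 0, 0, 0; 0, 0, 0, 0, 0, 0, 0, 0; 0, 0, 0, 0, 0, 0, 0, 0; 0, 0, -1, 0, 0, 0, 0, 0; 0, 0, 0, -1, 2, 0, 0, 0; 0, 0, 0, 0, 0, 0, 0, 0; 0, 0, 0, 0, 0, 0, 1, 0]]

def RZ : Fin 10 → Matrix (Fin 8) (Fin 8) ℤ :=
  ![!![0, 0, 0, 0, 0, 0, 1, 0; 0, 0, 0, 0, 0, 0, 0, -1; 0, 0, 0, 0, 0, 0, 0, 0; 0, 0, 0, 0, 0, 0, 0, 0; 0, 0, 0, 0, 0, 0, 0, 0; 0, 0, 0, 0, 0, 0, 0, 0; 0, 0, 0, 0, 0, 0, 0, 0; 0, 0, 0, 0, 0, 0, 0, 0],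
    !![0, 0, 0, -2, 1, 0, 0, 0; 0, 0, 0, 0, 0, -1, 0, 0; 0, 0, 0, 0, 0, 0, 1, 0; 0, 0, 0, 0, 0, 0, 0, 1; 0, 0, 0, 0, 0, 0, 0, 0; 0, 0, 0, 0, 0, 0, 0, 0; 0, 0, 0, 0, 0, 0, 0, 0; 0, 0, 0, 0, 0, 0, 0, 0],
    !![0, 0, 1, 0, 0, 0, 0, 0; 0, 0, 0, 1, 1, 0, 0, 0; 0, 0, 0, 0, 0, 0, 0, 0; 0, 0, 0, 0, 0, 0, -1, 0; 0, 0, 0, 0, 0, 0, -1, 0; 0, 0, 0, 0, 0, 0, 0, -1; 0, 0, 0, 0, 0, 0, 0, 0; 0, 0, 0, 0, 0, 0, 0, 0],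
    !![0, -2, 0, 0, 0, 0, 0, 0; 0, 0, 0, 0, 0, 0, 0, 0; 0, 0, 0, -4, 2, 0, 0, 0; 0, 0, 0, 0, 0, 2, 0, 0; 0, 0, 0, 0, 0, 0, 0, 0; 0, 0, 0, 0, 0, 0, 0, 0; 0, 0, 0, 0, 0, 0, 0, 2; 0, 0, 0, 0, 0, 0, 0, 0],
    !![-2, 0, 0, 0, 0, 0, 0, 0; 0, 2, 0, 0, 0, 0, 0, 0; 0, 0, 2, 0, 0, 0, 0, 0; 0, 0, 0, 2, -4, 0, 0, 0; 0, 0, 0, 4, -2, 0, 0, 0; 0, 0, 0, 0, 0, -2, 0, 0; 0, 0, 0, 0, 0, 0, -2, 0; 0, 0, 0, 0, 0, 0, 0, 2],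
    !![0, 0, 0, 0, 0, 0, 0, 0; 4, 0, 0, 0, 0, 0, 0, 0; 0, 0, 0, 0, 0, 0, 0, 0; 0, 0, -4, 0, 0, 0, 0, 0; 0, 0, -4, 0, 0, 0, 0, 0; 0, 0, 0, 4, 4, 0, 0, 0; 0, 0, 0, 0, 0, 0, 0, 0; 0, 0, 0, 0, 0, 0, -4, 0],
    !![0, 0, 0, 0, 0, 0, 0, 0; 0, 0, 0, 0, 0, 0, 0, 0; 0, -6, 0, 0, 0, 0, 0, 0; 0, 0, 0, 0, 0, 0, 0, 0; 0, 0, 0, 0, 0, 0, 0, 0; 0, 0, 0, 0, 0, 0, 0, 0; 0, 0, 0, 0, 0, 6, 0, 0; 0, 0, 0, 0, 0, 0, 0, 0],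
    !![0, 0, 0, 0, 0, 0, 0, 0; 0, 0, 0, 0, 0, 0, 0, 0; -6, 0, 0, 0, 0, 0, 0, 0; 0, 0, 0, 0, 0, 0, 0, 0; 0, 6, 0, 0, 0, 0, 0, 0; 0, 0, 0, 0, 0, 0, 0, 0; 0, 0, 0, 6, -12, 0, 0, 0; 0, 0, 0, 0, 0, 6, 0, 0],
    !![0, 0, 0, 0, 0, 0, 0, 0; 0, 0, 0, 0, 0, 0, 0, 0; 0, 0, 0, 0, 0, 0, 0, 0; 0, 0, 0, 0, 0, 0, 0, 0; 12, 0, 0, 0, 0, 0, 0, 0; 0, 12, 0, 0, 0, 0, 0, 0; 0, 0, -12, 0, 0, 0, 0, 0; 0, 0, 0, 12, -24, 0, 0, 0],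
    !![0, 0, 0, 0, 0, 0, 0, 0; 0, 0, 0, 0, 0, 0, 0, 0; 0, 0, 0, 0, 0, 0, 0, 0; 0, 0, 0, 0, 0, 0, 0, 0; 0, 0, 0, 0, 0, 0, 0, 0; 36, 0, 0, 0, 0, 0, 0, 0; 0, 0, 0, 0, 0, 0, 0, 0; 0, 0, -36, 0, 0, 0, 0, 0]]

def SZ : Fin 10 → Matrix (Fin 8) (Fin 8) ℤ :=
  ![!![0, 0, 0, 0, 0, 0, 0, 0; 0, 0, 0, 0, 0, 0, 0, 0; 0, 0, 0, 0, 0, 0, 0, 0; 0, 0, 0, 0, 0, 0, 0, 0; 0, 0, 0, 0, 0, 0, 0, 0; 0, 0, 0, 0, 0, 0, 0, 0; 36, 0, 0, 0, 0, 0, 0, 0; 0, -36, 0, 0, 0, 0, 0, 0],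
    !![0, 0, 0, 0, 0, 0, 0, 0; 0, 0, 0, 0, 0, 0, 0, 0; 0, 0, 0, 0, 0, 0, 0, 0; 12, 0, 0, 0, 0, 0, 0, 0; 0, 0, 0, 0, 0, 0, 0, 0; 0, 12, 0, 0, 0, 0, 0, 0; 0, 0, -12, 0, 0, 0, 0, 0; 0, 0, 0, -24, 12, 0, 0, 0],
    !![0, 0, 0, 0, 0, 0, 0, 0; 0, 0, 0, 0, 0, 0, 0, 0; 4, 0, 0, 0, 0, 0, 0, 0; 0, 4, 0, 0, 0, 0, 0, 0; 0, 4, 0, 0, 0, 0, 0, 0; 0, 0, 0, 0, 0, 0, 0, 0; 0, 0, 0, -4, -4, 0, 0, 0; 0, 0, 0, 0, 0, -4, 0, 0],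
    !![0, 0, 0, 0, 0, 0, 0, 0; -6, 0, 0, 0, 0, 0, 0, 0; 0, 0, 0, 0, 0, 0, 0, 0; 0, 0, -6, 0, 0, 0, 0, 0; 0, 0, 0, 0, 0, 0, 0, 0; 0, 0, 0, 12, -6, 0, 0, 0; 0, 0, 0, 0, 0, 0, 0, 0; 0, 0, 0, 0, 0, 0, 6, 0],
    !![2, 0, 0, 0, 0, 0, 0, 0; 0, -2, 0, 0, 0, 0, 0, 0; 0, 0, -2, 0, 0, 0, 0, 0; 0, 0, 0, 2, -4, 0, 0, 0; 0, 0, 0, 4, -2, 0, 0, 0; 0, 0, 0, 0, 0, 2, 0, 0; 0, 0, 0, 0, 0, 0, 2, 0; 0, 0, 0, 0, 0, 0, 0, -2],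
    !![0, 1, 0, 0, 0, 0, 0, 0; 0, 0, 0, 0, 0, 0, 0, 0; 0, 0, 0, -1, -1, 0, 0, 0; 0, 0, 0, 0, 0, 1, 0, 0; 0, 0, 0, 0, 0, 1, 0, 0; 0, 0, 0, 0, 0, 0, 0, 0; 0, 0, 0, 0, 0, 0, 0, -1; 0, 0, 0, 0, 0, 0, 0, 0],
    !![0, 0, 0, 0, 0, 0, 0, 0; 0, 0, 6, 0, 0, 0, 0, 0; 0, 0, 0, 0, 0, 0, 0, 0; 0, 0, 0, 0, 0, 0, 0, 0; 0, 0, 0, 0, 0, 0, 0, 0; 0, 0, 0, 0, 0, 0, -6, 0; 0, 0, 0, 0, 0, 0, 0, 0; 0, 0, 0, 0, 0, 0, 0, 0],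
    !![0, 0, -2, 0, 0, 0, 0, 0; 0, 0, 0, -2, 4, 0, 0, 0; 0, 0, 0, 0, 0, 0, 0, 0; 0, 0, 0, 0, 0, 0, 0, 0; 0, 0, 0, 0, 0, 0, -2, 0; 0, 0, 0, 0, 0, 0, 0, 2; 0, 0, 0, 0, 0, 0, 0, 0; 0, 0, 0, 0, 0, 0, 0, 0],
    !![0, 0, 0, 1, -2, 0, 0, 0; 0, 0, 0, 0, 0, -1, 0, 0; 0, 0, 0, 0, 0, 0, 1, 0; 0, 0, 0, 0, 0, 0, 0, 0; 0, 0, 0, 0, 0, 0, 0, 1; 0, 0, 0, 0, 0, 0, 0, 0; 0, 0, 0, 0, 0, 0, 0, 0; 0, 0, 0, 0, 0, 0, 0, 0],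
    !![0, 0, 0, 0, 0, 1, 0, 0; 0, 0, 0, 0, 0, 0, 0, 0; 0, 0, 0, 0, 0, 0, 0, -1; 0, 0, 0, 0, 0, 0, 0, 0; 0, 0, 0, 0, 0, 0, 0, 0; 0, 0, 0, 0, 0, 0, 0, 0; 0, 0, 0, 0, 0, 0, 0, 0; 0, 0, 0, 0, 0, 0, 0, 0]]

/-- Integral forms of `A`, `coords` and `ad`. -/
def AZ : Fin 8 → Matrix (Fin 3) (Fin 3) ℤ :=
  ![!![0, 0, 1; 0, 0, 0; 0, 0, 0], !![0, 1, 0; 0, 0, 0; 0, 0, 0], !![0, 0, 0; 0, 0, 1; 0, 0, 0],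
    !![1, 0, 0; 0, -1, 0; 0, 0, 0], !![0, 0, 0; 0, 1, 0; 0, 0, -1],
    !![0, 0, 0; 0, 0, 0; 0, 1, 0], !![0, 0, 0; 1, 0, 0; 0, 0, 0], !![0, 0, 0; 0, 0, 0; 1, 0, 0]]

def coordsZ (X : Matrix (Fin 3) (Fin 3) ℤ) : Fin 8 → ℤ :=
  ![X 0 2, X 0 1, X 1 2, X 0 0, X 0 0 + X 1 1, X 2 1, X 1 0, X 2 0]

def adZ (X : Matrix (Fin 3) (Fin 3) ℤ) : Matrix (Fin 8) (Fin 8) ℤ :=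
  Matrix.of fun i j => coordsZ (X * AZ j - AZ j * X) i

lemma A_eq (j : Fin 8) : A j = (AZ j).map (Int.castRingHom ℝ) := by
  ext a b
  fin_cases j <;> fin_cases a <;> fin_cases b <;> simp [A, AZ]

lemma coords_cast (X : Matrix (Fin 3) (Fin 3) ℤ) (i : Fin 8) :
    coords (X.map (Int.castRingHom ℝ)) i = coordsZ X i := by
  fin_cases i <;> simp [coords, coordsZ]

lemma ad_cast (X : Matrix (Fin 3) (Fin 3) ℤ) : ad (X.map (Int.castRingHom ℝ)) = cst (adZ X) := by
  ext i j
  have h : X.map (Int.castRingHom ℝ) * A j - A j * X.map (Int.castRingHom ℝ) =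
      (X * AZ j - AZ j * X).map (Int.castRingHom ℝ) := by
    rw [A_eq, ← Matrix.map_mul, ← Matrix.map_mul, Matrix.map_sub]
    exact fun a b => map_sub _ a b
  simp only [ad, Matrix.of_apply, h, coords_cast, cst, adZ, Matrix.map_apply, eq_intCast]

lemma ad_single (i j : Fin 3) : ad (Matrix.single i j 1) = cst (adZ (Matrix.single i j 1)) := by
  rw [← ad_cast, Matrix.map_single]
  simp

lemma ad_e_one : ad (e 1).1 = cst (eZ 1) := by
  have h : adZ (Matrix.single 1 0 1) = eZ 1 := by decide +kernel
  rw [← h, ← ad_single]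
  rfl

lemma ad_e_two : ad (e 2).1 = cst (eZ 2) := by
  have h : adZ (Matrix.single 2 1 1) = eZ 2 := by decide +kernel
  rw [← h, ← ad_single]
  rfl

lemma brE_one (X Y : Matrix (Fin 8) (Fin 8) ℤ) (h : eZ 1 * X - X * eZ 1 = Y) :
    brE 1 (cst X) = cst Y := by
  rw [brE, ad_e_one, Ring.lie_def, cst_mul, cst_mul, cst_sub, h]

lemma brE_two (X Y : Matrix (Fin 8) (Fin 8) ℤ) (h : eZ 2 * X - X * eZ 2 = Y) :
    brE 2 (cst X) = cst Y := by
  rw [brE, ad_e_two, Ring.lie_def, cst_mul, cst_mul, cst_sub, h]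

lemma R_2_1_eq : R_2_1 = cst (RZ 0) := by
  ext i j
  fin_cases i <;> fin_cases j <;> simp [R_2_1, unit8, cst, RZ]

lemma S_1_2_eq : S_1_2 = cst (SZ 9) := by
  ext i j
  fin_cases i <;> fin_cases j <;> simp [S_1_2, unit8, cst, SZ]

lemma R_1_1_eq : R_1_1 = cst (RZ 1) := by
  rw [R_1_1, R_2_1_eq]
  exact brE_one _ _ (by decide +kernel)

lemma R_1_0_eq : R_1_0 = cst (RZ 2) := by
  rw [R_1_0, R_1_1_eq]
  exact brE_two _ _ (by decide +kernel)

lemma R_0_1_eq : R_0_1 = cst (RZ 3) := by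
  rw [R_0_1, R_1_1_eq]
  exact brE_one _ _ (by decide +kernel)

lemma R_0_0_eq : R_0_0 = cst (RZ 4) := by
  rw [R_0_0, R_0_1_eq]
  exact brE_two _ _ (by decide +kernel)

lemma R_0_m1_eq : R_0_m1 = cst (RZ 5) := by
  rw [R_0_m1, R_0_0_eq]
  exact brE_two _ _ (by decide +kernel)

lemma R_m1_1_eq : R_m1_1 = cst (RZ 6) := by
  rw [R_m1_1, R_0_1_eq]
  exact brE_one _ _ (by decide +kernel)

lemma R_m1_0_eq : R_m1_0 = cst (RZ 7) := by
  rw [R_m1_0, R_m1_1_eq]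
  exact brE_two _ _ (by decide +kernel)

lemma R_m1_m1_eq : R_m1_m1 = cst (RZ 8) := by
  rw [R_m1_m1, R_m1_0_eq]
  exact brE_two _ _ (by decide +kernel)

lemma R_m1_m2_eq : R_m1_m2 = cst (RZ 9) := by
  rw [R_m1_m2, R_m1_m1_eq]
  exact brE_two _ _ (by decide +kernel)

lemma S_1_1_eq : S_1_1 = cst (SZ 8) := by
  rw [S_1_1, S_1_2_eq]
  exact brE_two _ _ (by decide +kernel)

lemma S_0_1_eq : S_0_1 = cst (SZ 5) := by
  rw [S_0_1, S_1_1_eq]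
  exact brE_one _ _ (by decide +kernel)

lemma S_1_0_eq : S_1_0 = cst (SZ 7) := by
  rw [S_1_0, S_1_1_eq]
  exact brE_two _ _ (by decide +kernel)

lemma S_0_0_eq : S_0_0 = cst (SZ 4) := by
  rw [S_0_0, S_1_0_eq]
  exact brE_one _ _ (by decide +kernel)

lemma S_m1_0_eq : S_m1_0 = cst (SZ 2) := by
  rw [S_m1_0, S_0_0_eq]
  exact brE_one _ _ (by decide +kernel)

lemma S_1_m1_eq : S_1_m1 = cst (SZ 6) := by
  rw [S_1_m1, S_1_0_eq]
  exact brE_two _ _ (by decide +kernel)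

lemma S_0_m1_eq : S_0_m1 = cst (SZ 3) := by
  rw [S_0_m1, S_1_m1_eq]
  exact brE_one _ _ (by decide +kernel)

lemma S_m1_m1_eq : S_m1_m1 = cst (SZ 1) := by
  rw [S_m1_m1, S_0_m1_eq]
  exact brE_one _ _ (by decide +kernel)

lemma S_m2_m1_eq : S_m2_m1 = cst (SZ 0) := by
  rw [S_m2_m1, S_m1_m1_eq]
  exact brE_one _ _ (by decide +kernel)

lemma R_eq (k : Fin 10) : R k = cst (RZ k) := by
  fin_cases k
  · exact R_2_1_eq
  · exact R_1_1_eq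
  · exact R_1_0_eq
  · exact R_0_1_eq
  · exact R_0_0_eq
  · exact R_0_m1_eq
  · exact R_m1_1_eq
  · exact R_m1_0_eq
  · exact R_m1_m1_eq
  · exact R_m1_m2_eq

lemma S_eq (k : Fin 10) : S k = cst (SZ k) := by
  fin_cases k
  · exact S_m2_m1_eq
  · exact S_m1_m1_eq
  · exact S_m1_0_eq
  · exact S_0_m1_eq
  · exact S_0_0_eq
  · exact S_0_1_eq
  · exact S_1_m1_eq
  · exact S_1_0_eq
  · exact S_1_1_eq
  · exact S_1_2_eq

lemma ad_single_sum :
    ad (Matrix.single 0 0 1) + ad (Matrix.single 1 1 1) + ad (Matrix.single 2 2 1) = 0 := by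
  have h : -adZ (Matrix.single 0 0 1) - adZ (Matrix.single 1 1 1) = adZ (Matrix.single 2 2 1) := by
    decide +kernel
  rw [ad_single, ad_single, ad_single, ← h, ← cst_sub]
  have h' : cst (-adZ (Matrix.single 0 0 1)) = -cst (adZ (Matrix.single 0 0 1)) := by
    ext i j
    simp [cst]
  rw [h']
  abel

/-- The projection of `𝔩 = 𝔤 ⊕ 𝔤^⊥` onto `𝔤`. For `X : V → V` it is the unique `Y ∈ 𝔰𝔩(3,ℝ)` with
`tr (ad Y ad Z) = tr (X ad Z)` for all `Z ∈ 𝔰𝔩(3,ℝ)` (see `prG_spec`); recall that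
`tr (ad Y ad Z) = 6 tr (Y Z)`. -/
def prG : Mat8 →ₗ[ℝ] g where
  toFun X := ⟨Matrix.of fun i j => (X * ad (Matrix.single j i 1)).trace / 6, by
    refine LinearMap.mem_ker.2 ?_
    have h := congrArg (fun Y => (X * Y).trace) ad_single_sum
    simp only [Matrix.mul_add, Matrix.trace_add, Matrix.mul_zero, Matrix.trace_zero] at h
    simp only [Matrix.traceLinearMap_apply]
    rw [Matrix.trace_fin_three]
    simp only [Matrix.of_apply]
    linarith⟩
  map_add' X Y := by
    ext i j
    simp [Matrix.add_mul, add_div]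
  map_smul' c X := by
    ext i j
    simp [mul_div_assoc]

lemma coords_add (X Y : Matrix (Fin 3) (Fin 3) ℝ) : coords (X + Y) = coords X + coords Y := by
  ext i
  fin_cases i <;> simp [coords]
  ring

lemma coords_smul (c : ℝ) (X : Matrix (Fin 3) (Fin 3) ℝ) : coords (c • X) = c • coords X := by
  ext i
  fin_cases i <;> simp [coords]
  ring

/-- `ad` as a linear map. -/
def adL : Matrix (Fin 3) (Fin 3) ℝ →ₗ[ℝ] Mat8 where
  toFun := ad
  map_add' X Y := by
    ext i j
    have h : (X + Y) * A j - A j * (X + Y) = (X * A j - A j * X) + (Y * A j - A j * Y) := by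
      noncomm_ring
    simp only [ad, Matrix.of_apply, Matrix.add_apply, h, coords_add, Pi.add_apply]
  map_smul' c X := by
    ext i j
    have h : (c • X) * A j - A j * (c • X) = c • (X * A j - A j * X) := by
      rw [Matrix.smul_mul, Matrix.mul_smul, smul_sub]
    simp only [ad, Matrix.of_apply, Matrix.smul_apply, h, coords_smul, Pi.smul_apply,
      RingHom.id_apply]

lemma ad_sum (Z : Matrix (Fin 3) (Fin 3) ℝ) :
    ad Z = ∑ i, ∑ j, Z i j • ad (Matrix.single i j 1) := by
  have h : Z = ∑ i, ∑ j, Z i j • Matrix.single i j (1 : ℝ) := by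
    conv_lhs => rw [Matrix.matrix_eq_sum_single Z]
    simp
  change adL Z = ∑ i, ∑ j, Z i j • adL (Matrix.single i j 1)
  conv_lhs => rw [h]
  simp only [map_sum, map_smul]

lemma trace_ad_single (i j m n : Fin 3) :
    (ad (Matrix.single i j 1) * ad (Matrix.single m n 1)).trace =
      (if j = m ∧ i = n then 6 else 0) - if i = j ∧ m = n then 2 else 0 := by
  have h : ∀ i j m n : Fin 3, (adZ (Matrix.single i j 1) * adZ (Matrix.single m n 1)).trace =
      (if j = m ∧ i = n then 6 else 0) - if i = j ∧ m = n then 2 else 0 := by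
    decide +kernel
  rw [ad_single, ad_single, cst_mul, cst_trace, h]
  split_ifs <;> norm_num

lemma trace_ad_mul_ad (Y Z : Matrix (Fin 3) (Fin 3) ℝ) :
    (ad Y * ad Z).trace = 6 * (Y * Z).trace - 2 * Y.trace * Z.trace := by
  rw [ad_sum Y, ad_sum Z]
  simp only [Finset.sum_mul, Finset.mul_sum, Matrix.trace_sum, Matrix.smul_mul, Matrix.mul_smul,
    Matrix.trace_smul, trace_ad_single]
  simp only [Matrix.trace_fin_three, Matrix.mul_apply, Fin.sum_univ_three]
  simp
  ring

lemma prG_spec (X : Mat8) (Z : g) : (ad (prG X).1 * ad Z.1).trace = (X * ad Z.1).trace := by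
  have h0 : (prG X).1.trace = 0 := LinearMap.mem_ker.1 (prG X).2
  rw [trace_ad_mul_ad, h0, ad_sum Z.1]
  simp only [Matrix.mul_sum, Matrix.trace_sum, Matrix.mul_smul, Matrix.trace_smul, smul_eq_mul]
  rw [Matrix.trace_fin_three]
  simp only [Matrix.mul_apply, Fin.sum_univ_three, prG, LinearMap.coe_mk, AddHom.coe_mk,
    Matrix.of_apply]
  ring

lemma prG_ad (Z : g) : prG (ad Z.1) = Z := by
  have h0 : Z.1.trace = 0 := LinearMap.mem_ker.1 Z.2
  ext i j
  simp only [prG, LinearMap.coe_mk, AddHom.coe_mk, Matrix.of_apply]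
  rw [trace_ad_mul_ad, h0, Matrix.trace_mul_single]
  simp

lemma trace_R_mul_S (k m : Fin 10) :
    (R k * S m).trace = if k = m then ![72, -72, 24, 72, -48, 24, -72, 72, -72, 72] k else 0 := by
  have h : ∀ k m : Fin 10, (RZ k * SZ m).trace =
      if k = m then (![72, -72, 24, 72, -48, 24, -72, 72, -72, 72] : Fin 10 → ℤ) k else 0 := by
    decide +kernel
  rw [R_eq, S_eq, cst_mul, cst_trace, h]
  split_ifs
  · fin_cases k <;> simp
  · simp

lemma trace_R_mul_R (k m : Fin 10) : (R k * R m).trace = 0 := by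
  have h : ∀ k m : Fin 10, (RZ k * RZ m).trace = 0 := by decide +kernel
  rw [R_eq, R_eq, cst_mul, cst_trace, h, Int.cast_zero]

lemma trace_S_mul_S (k m : Fin 10) : (S k * S m).trace = 0 := by
  have h : ∀ k m : Fin 10, (SZ k * SZ m).trace = 0 := by decide +kernel
  rw [S_eq, S_eq, cst_mul, cst_trace, h, Int.cast_zero]

lemma trace_R_mul_S_ne (k : Fin 10) : (R k * S k).trace ≠ 0 := by
  rw [trace_R_mul_S]
  fin_cases k <;> simp

lemma trace_ad_mul_R (X : Matrix (Fin 3) (Fin 3) ℝ) (k : Fin 10) : (ad X * R k).trace = 0 := by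
  have h : ∀ i j k, (adZ (Matrix.single i j 1) * RZ k).trace = 0 := by decide +kernel
  simp only [ad_sum X, Finset.sum_mul, Matrix.trace_sum, Matrix.smul_mul, Matrix.trace_smul,
    ad_single, R_eq, cst_mul, cst_trace, h, Int.cast_zero, smul_zero, Finset.sum_const_zero]

lemma trace_ad_mul_S (X : Matrix (Fin 3) (Fin 3) ℝ) (k : Fin 10) : (ad X * S k).trace = 0 := by
  have h : ∀ i j k, (adZ (Matrix.single i j 1) * SZ k).trace = 0 := by decide +kernel
  simp only [ad_sum X, Finset.sum_mul, Matrix.trace_sum, Matrix.smul_mul, Matrix.trace_smul,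
    ad_single, S_eq, cst_mul, cst_trace, h, Int.cast_zero, smul_zero, Finset.sum_const_zero]

lemma projR_apply (X : Mat8) :
    projR X = ∑ k, ((R k * S k).trace)⁻¹ • (X * S k).trace • R k := by
  simp [projR, LinearMap.sum_apply]

lemma projS_apply (X : Mat8) :
    projS X = ∑ k, ((R k * S k).trace)⁻¹ • (X * R k).trace • S k := by
  simp [projS, LinearMap.sum_apply]

lemma projR_R (k : Fin 10) : projR (R k) = R k := by
  rw [projR_apply, Finset.sum_eq_single k]
  · rw [smul_smul, inv_mul_cancel₀ (trace_R_mul_S_ne k), one_smul]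
  · intro m _ hm
    rw [trace_R_mul_S k m, if_neg hm.symm, zero_smul, smul_zero]
  · simp

lemma projR_S (k : Fin 10) : projR (S k) = 0 := by
  simp [projR_apply, trace_S_mul_S]

lemma projR_ad (X : g) : projR (ad X.1) = 0 := by
  simp [projR_apply, trace_ad_mul_S]

lemma projS_S (k : Fin 10) : projS (S k) = S k := by
  rw [projS_apply, Finset.sum_eq_single k]
  · rw [Matrix.trace_mul_comm (S k), smul_smul, inv_mul_cancel₀ (trace_R_mul_S_ne k), one_smul]
  · intro m _ hm
    rw [Matrix.trace_mul_comm (S k), trace_R_mul_S m k, if_neg hm, zero_smul, smul_zero]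
  · simp

lemma projS_R (k : Fin 10) : projS (R k) = 0 := by
  simp [projS_apply, trace_R_mul_R]

lemma projS_ad (X : g) : projS (ad X.1) = 0 := by
  simp [projS_apply, trace_ad_mul_R]

/-! ### The space `Hom(𝔤₋, 𝔩)`

Elements of `Hom(𝔤₋, 𝔩) = Hom(𝔤/𝔤⁰, 𝔩)` are represented by linear maps on `𝔤` that vanish
on `𝔤⁰`. -/

/-- `X ⊗ λ`, the map `x ↦ λ(x) X`. -/
def tens (X : Mat8) (lam : g →ₗ[ℝ] ℝ) : g →ₗ[ℝ] Mat8 := lam.smulRight X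

/-- The degrees of `A₁, …, A₈`: `deg E_{ij} = j - i`. -/
def degA : Fin 8 → ℤ := ![2, 1, 1, 0, 0, -1, -1, -2]

/-- The component of degree `k` of an element of `𝔤𝔩(V) = ⨁ 𝔤𝔩(V)_k`. -/
def degPart (k : ℤ) (X : Mat8) : Mat8 :=
  Matrix.of fun i j => if degA i - degA j = k then X i j else 0

/-- The degrees of `e₀, e₁, e₂`. -/
def degE : Fin 3 → ℤ := ![-2, -1, -1]

/-- The component of degree `p` of an element of `Hom(𝔤₋, 𝔩)`: it maps `𝔤_q` to `𝔩_{p+q}`, by the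
degree `p + q` part of `f`. -/
def homPart (p : ℤ) (f : g →ₗ[ℝ] Mat8) : g →ₗ[ℝ] Mat8 :=
  ∑ i, tens (degPart (p + degE i) (f (e i))) (eStar i)

/-- The codifferential `∂* : Hom(𝔤₋, 𝔩) → 𝔩`, `∂* f = ∑ [ěᵢ, f(eᵢ)]`, dual to the Lie algebra
differential `(∂ w)(x) = [x, w]`; see `codiff_adjoint`. -/
def codiff (f : g →ₗ[ℝ] Mat8) : Mat8 := ∑ i, ⁅ad (eCheck i).1, f (e i)⁆

/-- Under the trace form of `𝔩` and the induced identification `𝔤₋* = 𝔤₊`, the map `-∂*` is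
transposed to the Lie algebra differential `w ↦ (y ↦ [y, w])`, `𝔩 → Hom(𝔤₊, 𝔩)`. -/
lemma codiff_adjoint (f : g →ₗ[ℝ] Mat8) (w : Mat8) :
    (codiff f * w).trace = -∑ i, (f (e i) * ⁅ad (eCheck i).1, w⁆).trace := by
  rw [codiff, Finset.sum_mul, Matrix.trace_sum, ← Finset.sum_neg_distrib]
  refine Finset.sum_congr rfl fun i _ => ?_
  rw [Ring.lie_def, Ring.lie_def, Matrix.sub_mul, Matrix.mul_sub, Matrix.trace_sub,
    Matrix.trace_sub, Matrix.mul_assoc, Matrix.trace_mul_comm (ad (eCheck i).1), Matrix.mul_assoc,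
    Matrix.mul_assoc, neg_sub]

/-- The action `ρ` of `x ∈ 𝔤⁰` on `Hom(𝔤/𝔤⁰, 𝔩)`: `(ρ(x) f)(y) = [x, f(y)] - f([x, y])`. -/
def rho (x : g) (f : g →ₗ[ℝ] Mat8) : g →ₗ[ℝ] Mat8 where
  toFun y := ⁅ad x.1, f y⁆ - f ⁅x, y⁆
  map_add' y z := by
    simp only [map_add, lie_add]
    abel
  map_smul' c y := by
    simp only [map_smul, lie_smul, RingHom.id_apply, smul_sub]

/-- `ξ₁^R = R_{-1,1} ⊗ e₂*`. -/
def xiR : g →ₗ[ℝ] Mat8 := tens R_m1_1 (eStar 2)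

/-- `ξ₁^S = S_{1,-1} ⊗ e₁*`. -/
def xiS : g →ₗ[ℝ] Mat8 := tens S_1_m1 (eStar 1)

/-! ### The structure group -/

/-- `G⁰`, the Borel subgroup of upper triangular matrices of `SL(3,ℝ)`. -/
def G0 : Subgroup (Matrix.SpecialLinearGroup (Fin 3) ℝ) where
  carrier := {a | Matrix.BlockTriangular a.1 id}
  one_mem' := Matrix.blockTriangular_one
  mul_mem' ha hb := Matrix.BlockTriangular.mul ha hb
  inv_mem' := by
    intro a ha
    have hinv : Invertible a.1 := Matrix.invertibleOfIsUnitDet a.1 (by simp)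
    have h := Matrix.blockTriangular_inv_of_blockTriangular (M := a.1) (b := id) ha
    have h2 : (a⁻¹).1 = (a.1)⁻¹ := by
      refine (Matrix.inv_eq_left_inv ?_).symm
      exact congrArg Subtype.val (inv_mul_cancel a)
    change Matrix.BlockTriangular (a⁻¹).1 id
    rw [h2]
    exact h

/-- Global coordinates `(ℝˣ × ℝˣ) × ℝ³ → G⁰` on the Lie group `G⁰`. -/
def G0.mk (q : (ℝˣ × ℝˣ) × (Fin 3 → ℝ)) : G0 :=
  ⟨⟨!![(q.1.1 : ℝ), q.2 0, q.2 1; 0, (q.1.2 : ℝ), q.2 2; 0, 0, ((q.1.1 * q.1.2)⁻¹ : ℝˣ)], by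
    rw [Matrix.det_fin_three]
    have h1 := q.1.1.ne_zero
    have h2 := q.1.2.ne_zero
    simp
    field_simp⟩, by
    change Matrix.BlockTriangular _ _
    intro i j hij
    fin_cases i <;> fin_cases j <;> simp_all⟩

lemma G0.mk_bijective : Function.Bijective G0.mk := by
  constructor
  · rintro ⟨⟨s, t⟩, x⟩ ⟨⟨s', t'⟩, x'⟩ h
    have h' : ∀ i j, (G0.mk ⟨⟨s, t⟩, x⟩).1.1 i j = (G0.mk ⟨⟨s', t'⟩, x'⟩).1.1 i j := by
      rw [h]
      exact fun _ _ => rfl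
    have h0 := h' 0 0
    have h1 := h' 1 1
    have h2 := h' 0 1
    have h3 := h' 0 2
    have h4 := h' 1 2
    simp [G0.mk] at h0 h1 h2 h3 h4
    have hx : x = x' := by
      ext i
      fin_cases i
      exacts [h2, h3, h4]
    rw [Units.ext h0, Units.ext h1, hx]
  · rintro ⟨⟨a, hdet⟩, ha⟩
    have ha' : Matrix.BlockTriangular a id := ha
    have h1 : a 1 0 = 0 := ha' (by decide : id (0 : Fin 3) < id 1)
    have h2 : a 2 0 = 0 := ha' (by decide : id (0 : Fin 3) < id 2)
    have h3 : a 2 1 = 0 := ha' (by decide : id (1 : Fin 3) < id 2)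
    have hd := hdet
    rw [Matrix.det_fin_three, h1, h2, h3] at hd
    simp at hd
    have n0 : a 0 0 ≠ 0 := by
      intro h
      simp [h] at hd
    have n1 : a 1 1 ≠ 0 := by
      intro h
      simp [h] at hd
    refine ⟨⟨⟨Units.mk0 _ n0, Units.mk0 _ n1⟩, ![a 0 1, a 0 2, a 1 2]⟩, ?_⟩
    apply Subtype.ext
    apply Subtype.ext
    ext i j
    fin_cases i <;> fin_cases j <;> simp [G0.mk, h1, h2, h3]
    field_simp
    linarith

/-! ### Normal extrinsic Cartan connections -/

section Connection

variable (M P : Type*)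
  [TopologicalSpace M] [ChartedSpace (EuclideanSpace ℝ (Fin 3)) M]
  [TopologicalSpace P] [ChartedSpace (EuclideanSpace ℝ (Fin 8)) P]

/-- A principal bundle `P → M` with structure group `G⁰`, acting on `P` from the right. -/
structure PrincipalG0Bundle where
  /-- The projection `π : P → M`. -/
  proj : P → M
  /-- The right action `(z, a) ↦ z a`. -/
  act : P → G0 → P
  act_one : ∀ z, act z 1 = z
  act_mul : ∀ z a b, act z (a * b) = act (act z a) b
  contMDiff_proj : ContMDiff (𝓡 8) (𝓡 3) ∞ proj
  /-- The action is a smooth map `P × G⁰ → P`, written in the coordinates `G0.mk` of `G⁰`. -/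
  contMDiff_act : ContMDiff ((𝓡 8).prod ((𝓘(ℝ, ℝ).prod 𝓘(ℝ, ℝ)).prod 𝓘(ℝ, Fin 3 → ℝ))) (𝓡 8) ∞
    (fun p : P × ((ℝˣ × ℝˣ) × (Fin 3 → ℝ)) => act p.1 (G0.mk p.2))
  proj_act : ∀ z a, proj (act z a) = proj z
  act_free : ∀ z a, act z a = z → a = 1
  /-- Local triviality: around each point of `M` there are an open set `U`, a smooth section `s` over
  `U` and a smooth map `τ : π⁻¹(U) → G⁰` with `z = s(π(z)) τ(z)`; that is,
  `z ↦ (π(z), τ(z))` is an equivariant diffeomorphism `π⁻¹(U) → U × G⁰`. -/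
  locally_trivial : ∀ x : M, ∃ U : Set M, IsOpen U ∧ x ∈ U ∧ ∃ (s : M → P) (τ : P → G0),
    ContMDiffOn (𝓡 3) (𝓡 8) ∞ s U ∧ (∀ y ∈ U, proj (s y) = y) ∧
    (∀ i j, ContMDiffOn (𝓡 8) 𝓘(ℝ, ℝ) ∞ (fun z => (τ z).1.1 i j) (proj ⁻¹' U)) ∧
    ∀ z ∈ proj ⁻¹' U, z = act (s (proj z)) (τ z)

variable {M P}

/-- The derivative of a function along a vector field. -/
def derivAlong (X : ∀ z : P, TangentSpace (𝓡 8) z) (f : P → ℝ) (z : P) : ℝ :=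
  mfderiv (𝓡 8) 𝓘(ℝ, ℝ) f z (X z)

/-- Smooth vector fields on `P`. -/
def IsSmoothField (X : ∀ z : P, TangentSpace (𝓡 8) z) [IsManifold (𝓡 8) ∞ P] : Prop :=
  ContMDiff (𝓡 8) (𝓡 8).tangent ∞ (fun z => (⟨z, X z⟩ : TangentBundle (𝓡 8) P))

variable (M P) in
/-- An extrinsic Cartan connection `(P, ω)` of `𝔰𝔩₃` type over the three-dimensional manifold `M`:
a principal `G⁰`-bundle with an `𝔩`-valued `1`-form `ω` on its total space. -/
structure ExtrinsicCartanConnection [IsManifold (𝓡 8) ∞ P] extends PrincipalG0Bundle M P where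
  /-- The `1`-form `ω`. -/
  form : ∀ z : P, TangentSpace (𝓡 8) z →ₗ[ℝ] Mat8
  /-- `ω` takes its values in `𝔩`. -/
  form_mem : ∀ z v, form z v ∈ l
  /-- `ω` is smooth. -/
  contMDiff_form : ∀ i j, ContMDiff (𝓡 8).tangent 𝓘(ℝ, ℝ) ∞
    (fun v : TangentBundle (𝓡 8) P => form v.proj v.snd i j)
  /-- `⟨Ã, ω⟩ = A` for `A ∈ 𝔤⁰`, where `Ã` is the fundamental vector field of `A`: its value at `z`
  is the velocity at `t = 0` of `t ↦ z c(t)`, for the one-parameter subgroup `c` of `G⁰` with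
  `c'(0) = A`. -/
  form_fundamental : ∀ (z : P) (c : ℝ → G0), (∀ s t, c (s + t) = c s * c t) →
    (∀ i j, ContDiff ℝ ∞ (fun t => (c t).1.1 i j)) →
    form (act z (c 0)) (mfderiv 𝓘(ℝ, ℝ) (𝓡 8) (fun t : ℝ => act z (c t)) 0 (1 : ℝ)) =
      ad (Matrix.of fun i j => deriv (fun t => (c t).1.1 i j) 0)
  /-- `R_a^* ω = Ad(a⁻¹) ω` for `a ∈ G⁰` (whose infinitesimal form is `L_Ã ω = -ad(A) ω`). -/
  form_equivariant : ∀ (a : G0) (z : P) (v : TangentSpace (𝓡 8) z),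
    form (act z a) (mfderiv (𝓡 8) (𝓡 8) (fun w => act w a) z v) = Ad (a⁻¹).1 * form z v * Ad a.1
  /-- `dω + ½ [ω, ω] = 0`, where
  `dω(X, Y) = X(ω(Y)) - Y(ω(X)) - ω([X, Y])` and `½ [ω, ω](X, Y) = [ω(X), ω(Y)]`. -/
  structure_eq : ∀ X Y : (∀ z : P, TangentSpace (𝓡 8) z), IsSmoothField X → IsSmoothField Y →
    ∀ z i j,
      derivAlong X (fun w => form w (Y w) i j) z - derivAlong Y (fun w => form w (X w) i j) z
        - form z (VectorField.mlieBracket (𝓡 8) X Y z) i j + ⁅form z (X z), form z (Y z)⁆ i j = 0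
  /-- The `𝔤`-component `ω_I : T_zP → 𝔤` is a linear isomorphism. -/
  formI_bijective : ∀ z, Function.Bijective (prG ∘ₗ form z)

namespace ExtrinsicCartanConnection

variable [IsManifold (𝓡 8) ∞ P] (C : ExtrinsicCartanConnection M P)

/-- The `𝔤`-component `ω_I`, as an isomorphism `T_zP → 𝔤`. -/
def formI (z : P) : TangentSpace (𝓡 8) z ≃ₗ[ℝ] g :=
  LinearEquiv.ofBijective (prG ∘ₗ C.form z) (C.formI_bijective z)

/-- The `𝔤^⊥`-component `ω_II = ω - ω_I`. -/
def formII (z : P) : TangentSpace (𝓡 8) z →ₗ[ℝ] Mat8 :=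
  C.form z - adL ∘ₗ (LieAlgebra.SpecialLinear.sl (Fin 3) ℝ).toSubmodule.subtype ∘ₗ
    (C.formI z).toLinearMap

/-- The structure function `χ`, defined by `ω_II = χ ω_I`. -/
def χ (z : P) : g →ₗ[ℝ] Mat8 := C.formII z ∘ₗ (C.formI z).symm.toLinearMap

/-- The components `χ_p^R : P → Hom(𝔤₋, Γ_{3,0})` of degree `p`. -/
def χR (p : ℤ) (z : P) : g →ₗ[ℝ] Mat8 := homPart p (projR ∘ₗ C.χ z)

/-- The components `χ_p^S : P → Hom(𝔤₋, Γ_{0,3})` of degree `p`. -/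
def χS (p : ℤ) (z : P) : g →ₗ[ℝ] Mat8 := homPart p (projS ∘ₗ C.χ z)

/-- Normality: `∂* χ = 0`, and the components `χ_j`, `j ≤ 0`, vanish. -/
def IsNormal : Prop :=
  (∀ z, codiff (C.χ z) = 0) ∧ ∀ z, ∀ j ≤ 0, homPart j (C.χ z) = 0

/-- `D_x f`, the derivative of `f` along the vector field `ω_I⁻¹(x)`, for `x ∈ 𝔤`. -/
def D (x : g) (f : P → ℝ) : P → ℝ := derivAlong (fun z => (C.formI z).symm x) f

end ExtrinsicCartanConnection

end Connection

end SL3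

end

open SL3

open SL3

noncomputable section

namespace SL3

attribute [local instance 100] LieRing.ofAssociativeRing

/-! ### The basis of `𝔤^⊥` and its structure constants -/

/-! The structure equation is read off degree by degree. Evaluate it on the fields `ω_I⁻¹(e i)`,
`ω_I⁻¹(e j)`. Since `ω_I` is constant on these fields, the `𝔤`-part computes `ω_I` of their bracket.
The `𝔤^⊥`-part then becomes an equation for the coordinates `coord j K` of `χ`
(`structure_eq_coord`). In degree `p` it says that the Lie algebra differential of `χ_p` equals
first derivatives of components of lower degree plus terms of higher order in `χ`.

Normality adds `∂*χ = 0` and removes degrees `≤ 0`. So the new freedom in each degree is a harmonic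
element of `Hom(𝔤₋, 𝔤^⊥)`. In positive degree these are spanned by `ξ₁^R` and `ξ₁^S`, both of degree
1, in accordance with Kostant's description of `H¹(𝔤₋, Γ)`. Here this is not quoted but obtained by
solving small linear systems, whose coefficients are structure constants tabulated as integers.

The induction carries the set `Allowed` of positions occupied by `ρ(ě₁)^k ξ₁^R` and `ρ(ě₂)^k ξ₁^S`.
While the lower components live there, all nonlinear terms drop out for `p ≤ 5`
(`linear_structure_eq`), which covers every degree that occurs. Components of the equation with
neither index allowed contain no derivatives, and together with `∂*χ = 0` they kill the other
coordinates (`coord_eq_zero_of_not_allowed`). The remaining components express each allowed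
coordinate as a constant times `D_{e₁}^k h^R` or `D_{e₂}^k h^S` (`coord_R_two` to `coord_S_five`),
with `h^R = coord 2 6` and `h^S = coord 1 16`. -/

/-- The vectors `R k`, followed by the vectors `S k`, as integral matrices. -/
def perpZ : Fin 20 → Matrix (Fin 8) (Fin 8) ℤ := Fin.append RZ SZ

/-- The basis of `𝔤^⊥` consisting of the vectors `R k`, followed by the vectors `S k`. -/
def perp (K : Fin 20) : Mat8 := cst (perpZ K)

/-- The pairing of `perp K` with `perp (K + 10)`. -/
def normZ : Fin 20 → ℤ :=
  ![72, -72, 24, 72, -48, 24, -72, 72, -72, 72, 72, -72, 24, 72, -48, 24, -72, 72, -72, 72]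

/-- The degrees of the vectors `perp K`. -/
def degPerp : Fin 20 → ℤ :=
  ![3, 2, 1, 1, 0, -1, 0, -1, -2, -3, -3, -2, -1, -1, 0, 1, 0, 1, 2, 3]

/-- Integral form of `ad (e i)`. -/
def adEZ : Fin 3 → Matrix (Fin 8) (Fin 8) ℤ :=
  ![!![0, 0, 0, 0, 0, 0, 0, 0; 0, 0, 0, 0, 0, 0, 0, 0; 0, 0, 0, 0, 0, 0, 0, 0; -1, 0, 0, 0, 0, 0, 0, 0; -1, 0, 0, 0, 0, 0, 0, 0; 0, 1, 0, 0, 0, 0, 0, 0; 0, 0, -1, 0, 0, 0, 0, 0; 0, 0, 0, 1, 1, 0, 0, 0],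
    !![0, 0, 0, 0, 0, 0, 0, 0; 0, 0, 0, 0, 0, 0, 0, 0; 1, 0, 0, 0, 0, 0, 0, 0; 0, -1, 0, 0, 0, 0, 0, 0; 0, 0, 0, 0, 0, 0, 0, 0; 0, 0, 0, 0, 0, 0, 0, 0; 0, 0, 0, 2, -1, 0, 0, 0; 0, 0, 0, 0, 0, -1, 0, 0],
    !![0, 0, 0, 0, 0, 0, 0, 0; -1, 0, 0, 0, 0, 0, 0, 0; 0, 0, 0, 0, 0, 0, 0, 0; 0, 0, 0, 0, 0, 0, 0, 0; 0, 0, -1, 0, 0, 0, 0, 0; 0, 0, 0, -1, 2, 0, 0, 0; 0, 0, 0, 0, 0, 0, 0, 0; 0, 0, 0, 0, 0, 0, 1, 0]]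

/-- Integral form of `ad (eCheck i)`. -/
def adECheckZ : Fin 3 → Matrix (Fin 8) (Fin 8) ℤ :=
  ![!![0, 0, 0, -1, -1, 0, 0, 0; 0, 0, 0, 0, 0, 1, 0, 0; 0, 0, 0, 0, 0, 0, -1, 0; 0, 0, 0, 0, 0, 0, 0, 1; 0, 0, 0, 0, 0, 0, 0, 1; 0, 0, 0, 0, 0, 0, 0, 0; 0, 0, 0, 0, 0, 0, 0, 0; 0, 0, 0, 0, 0, 0, 0, 0],
    !![0, 0, 1, 0, 0, 0, 0, 0; 0, 0, 0, -2, 1, 0, 0, 0; 0, 0, 0, 0, 0, 0, 0, 0; 0, 0, 0, 0, 0, 0, 1, 0; 0, 0, 0, 0, 0, 0, 0, 0; 0, 0, 0, 0, 0, 0, 0, -1; 0, 0, 0, 0, 0, 0, 0, 0; 0, 0, 0, 0, 0, 0, 0, 0],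
    !![0, -1, 0, 0, 0, 0, 0, 0; 0, 0, 0, 0, 0, 0, 0, 0; 0, 0, 0, 1, -2, 0, 0, 0; 0, 0, 0, 0, 0, 0, 0, 0; 0, 0, 0, 0, 0, 1, 0, 0; 0, 0, 0, 0, 0, 0, 0, 0; 0, 0, 0, 0, 0, 0, 0, 1; 0, 0, 0, 0, 0, 0, 0, 0]]

/-- `6 [e i, perp L]` is the multiple `eScal i L` of `perp (eShift i L)`. -/
def eScal : Fin 3 → Fin 20 → ℤ :=
  ![![6, 3, 3, 2, 2, 2, 0, 0, 0, 0, 0, 0, -2, 0, -2, -3, 0, -2, -3, -6],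
    ![6, 6, 3, 6, 4, 2, 0, 0, 0, 0, 0, 6, 0, 6, 6, 0, 6, 6, 6, 0],
    ![0, 6, 0, 6, 6, 0, 6, 6, 6, 0, 0, 0, 2, 0, 4, 3, 0, 6, 6, 6]]

/-- The weight spaces of `Γ_{3,0}` and `Γ_{0,3}` are lines, so a root vector carries each basis
vector to a multiple of another one. The factor 6 clears the denominators 2 and 3. Where the
multiple is 0, the entry here is a filler, as in the other three shift tables. -/
def eShift : Fin 3 → Fin 20 → Fin 20 :=
  ![![2, 4, 5, 7, 8, 9, 6, 7, 8, 9, 10, 11, 10, 13, 11, 12, 16, 13, 14, 15],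
    ![1, 3, 4, 6, 7, 8, 6, 7, 8, 9, 10, 10, 12, 11, 12, 15, 13, 14, 15, 19],
    ![0, 2, 2, 4, 5, 5, 7, 8, 9, 9, 10, 11, 11, 13, 13, 14, 16, 16, 17, 18]]

/-- `6 [e i, perp (eBack i K)]` is the multiple `eBackScal i K` of `perp K`. -/
def eBackScal : Fin 3 → Fin 20 → ℤ :=
  ![![0, 0, 6, 0, 3, 3, 0, 2, 2, 2, -2, -2, -3, -2, -3, -6, 0, 0, 0, 0],
    ![0, 6, 0, 6, 3, 0, 6, 4, 2, 0, 6, 6, 6, 6, 6, 6, 0, 0, 0, 0],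
    ![0, 0, 6, 0, 6, 6, 0, 6, 6, 6, 0, 2, 0, 4, 3, 0, 6, 6, 6, 0]]

def eBack : Fin 3 → Fin 20 → Fin 20 :=
  ![![0, 0, 0, 0, 1, 2, 0, 3, 4, 5, 12, 14, 15, 17, 18, 19, 0, 0, 0, 0],
    ![0, 0, 0, 1, 2, 0, 3, 4, 5, 0, 11, 13, 14, 16, 17, 18, 0, 0, 0, 0],
    ![0, 0, 1, 0, 3, 4, 0, 6, 7, 8, 0, 12, 0, 14, 15, 0, 17, 18, 19, 0]]

/-- `6 [eCheck i, perp L]` is the multiple `eCheckScal i L` of `perp (eCheckShift i L)`. -/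
def eCheckScal : Fin 3 → Fin 20 → ℤ :=
  ![![0, 0, 18, 0, 24, 48, 0, 18, 36, 54, -54, -36, -48, -18, -24, -18, 0, 0, 0, 0],
    ![0, 18, 0, 24, 24, 0, 18, 18, 18, 0, 18, 24, 12, 18, 12, 6, 0, 0, 0, 0],
    ![0, 0, 6, 0, 12, 12, 0, 18, 24, 18, 0, 18, 0, 18, 24, 0, 18, 24, 18, 0]]

def eCheckShift : Fin 3 → Fin 20 → Fin 20 :=
  ![![0, 1, 0, 3, 1, 2, 6, 3, 4, 5, 12, 14, 15, 17, 18, 19, 16, 17, 18, 19],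
    ![0, 0, 2, 1, 2, 5, 3, 4, 5, 9, 11, 13, 14, 16, 17, 18, 16, 17, 18, 19],
    ![0, 1, 1, 3, 3, 4, 6, 6, 7, 8, 10, 12, 12, 14, 15, 15, 17, 18, 19, 19]]

/-- `6 [eCheck i, perp (eCheckBack i K)]` is the multiple `eCheckBackScal i K` of `perp K`. -/
def eCheckBackScal : Fin 3 → Fin 20 → ℤ :=
  ![![18, 24, 48, 18, 36, 54, 0, 0, 0, 0, 0, 0, -54, 0, -36, -48, 0, -18, -24, -18],
    ![18, 24, 24, 18, 18, 18, 0, 0, 0, 0, 0, 18, 0, 24, 12, 0, 18, 12, 6, 0],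
    ![0, 6, 0, 12, 12, 0, 18, 24, 18, 0, 0, 0, 18, 0, 18, 24, 0, 18, 24, 18]]

def eCheckBack : Fin 3 → Fin 20 → Fin 20 :=
  ![![2, 4, 5, 7, 8, 9, 0, 0, 0, 0, 0, 0, 10, 0, 11, 12, 0, 13, 14, 15],
    ![1, 3, 4, 6, 7, 8, 0, 0, 0, 0, 0, 10, 0, 11, 12, 0, 13, 14, 15, 0],
    ![0, 2, 0, 4, 5, 0, 7, 8, 9, 0, 0, 0, 11, 0, 13, 14, 0, 16, 17, 18]]

/-- The Gram matrix of the Killing form. -/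
def kappaZ : Matrix (Fin 8) (Fin 8) ℤ :=
  !![0, 0, 0, 0, 0, 0, 0, 6; 0, 0, 0, 0, 0, 0, 6, 0; 0, 0, 0, 0, 0, 6, 0, 0; 0, 0, 0, 12, -6, 0, 0, 0; 0, 0, 0, -6, 12, 0, 0, 0; 0, 0, 6, 0, 0, 0, 0, 0; 0, 6, 0, 0, 0, 0, 0, 0; 6, 0, 0, 0, 0, 0, 0, 0]

/-- `18` times the inverse of the Gram matrix of the Killing form. -/
def kappaInvZ : Matrix (Fin 8) (Fin 8) ℤ :=
  !![0, 0, 0, 0, 0, 0, 0, 3; 0, 0, 0, 0, 0, 0, 3, 0; 0, 0, 0, 0, 0, 3, 0, 0; 0, 0, 0, 2, 1, 0, 0, 0; 0, 0, 0, 1, 2, 0, 0, 0; 0, 0, 3, 0, 0, 0, 0, 0; 0, 3, 0, 0, 0, 0, 0, 0; 3, 0, 0, 0, 0, 0, 0, 0]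

lemma perp_castAdd (k : Fin 10) : perp (Fin.castAdd 10 k) = R k := by
  rw [perp, perpZ, Fin.append_left, R_eq]

lemma perp_natAdd (k : Fin 10) : perp (Fin.natAdd 10 k) = S k := by
  rw [perp, perpZ, Fin.append_right, S_eq]

lemma ad_e (i : Fin 3) : ad (e i).1 = cst (adEZ i) := by
  have h : ∀ i : Fin 3, adZ (Matrix.single (![2, 1, 2] i) (![0, 0, 1] i) 1) = adEZ i := by
    decide +kernel
  rw [← h, ← ad_single]
  fin_cases i <;> rfl

lemma ad_eCheck (i : Fin 3) : ad (eCheck i).1 = cst (adECheckZ i) := by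
  have h : ∀ i : Fin 3, adZ (Matrix.single (![0, 0, 1] i) (![2, 1, 2] i) 1) = adECheckZ i := by
    decide +kernel
  rw [← h, ← ad_single]
  fin_cases i <;> rfl

lemma cst_lie (X Y : Matrix (Fin 8) (Fin 8) ℤ) : ⁅cst X, cst Y⁆ = cst (X * Y - Y * X) := by
  rw [Ring.lie_def, cst_mul, cst_mul, cst_sub]

lemma cst_smul (c : ℤ) (X : Matrix (Fin 8) (Fin 8) ℤ) : cst (c • X) = (c : ℝ) • cst X := by
  ext i j
  simp only [cst, Matrix.map_apply, Matrix.smul_apply, smul_eq_mul, map_mul, eq_intCast]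

lemma normZ_ne_zero (K : Fin 20) : (normZ K : ℝ) ≠ 0 := by
  have h : ∀ K, normZ K ≠ 0 := by decide +kernel
  exact_mod_cast h K

lemma trace_perp_mul_perp (K L : Fin 20) :
    (perp L * perp (K + 10)).trace = if L = K then (normZ K : ℝ) else 0 := by
  have h : ∀ K L, (perpZ L * perpZ (K + 10)).trace = if L = K then normZ K else 0 := by
    decide +kernel
  rw [perp, perp, cst_mul, cst_trace, h]
  split_ifs <;> simp

lemma lie_e_perp (i : Fin 3) (L : Fin 20) :
    ⁅ad (e i).1, perp L⁆ = ((eScal i L : ℝ) / 6) • perp (eShift i L) := by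
  have h : ∀ i L, (6 : ℤ) • (adEZ i * perpZ L - perpZ L * adEZ i) =
      eScal i L • perpZ (eShift i L) := by decide +kernel
  have h' := congrArg cst (h i L)
  rw [cst_smul, cst_smul] at h'
  rw [ad_e, perp, cst_lie, div_eq_inv_mul, ← smul_smul, perp, ← h', smul_smul]
  norm_num

lemma lie_eCheck_perp (i : Fin 3) (L : Fin 20) :
    ⁅ad (eCheck i).1, perp L⁆ = ((eCheckScal i L : ℝ) / 6) • perp (eCheckShift i L) := by
  have h : ∀ i L, (6 : ℤ) • (adECheckZ i * perpZ L - perpZ L * adECheckZ i) =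
      eCheckScal i L • perpZ (eCheckShift i L) := by decide +kernel
  have h' := congrArg cst (h i L)
  rw [cst_smul, cst_smul] at h'
  rw [ad_eCheck, perp, cst_lie, div_eq_inv_mul, ← smul_smul, perp, ← h', smul_smul]
  norm_num

/-- The `K`-th coordinate of the component in `𝔤^⊥`. -/
def coef (K : Fin 20) : Mat8 →ₗ[ℝ] ℝ :=
  (normZ K : ℝ)⁻¹ • (Matrix.traceLinearMap (Fin 8) ℝ ℝ).comp (LinearMap.mulRight ℝ (perp (K + 10)))

lemma coef_apply (K : Fin 20) (X : Mat8) :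
    coef K X = (normZ K : ℝ)⁻¹ * (X * perp (K + 10)).trace := by
  simp [coef]

lemma coef_perp (K L : Fin 20) : coef K (perp L) = if L = K then 1 else 0 := by
  rw [coef_apply, trace_perp_mul_perp]
  split_ifs
  · exact inv_mul_cancel₀ (normZ_ne_zero K)
  · exact mul_zero _

lemma trace_ad_mul_perp (X : Matrix (Fin 3) (Fin 3) ℝ) (K : Fin 20) :
    (ad X * perp K).trace = 0 := by
  refine Fin.addCases (m := 10) (n := 10) (fun k => ?_) (fun k => ?_) K
  · rw [perp_castAdd, trace_ad_mul_R]
  · rw [perp_natAdd, trace_ad_mul_S]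

lemma coef_ad (K : Fin 20) (X : Matrix (Fin 3) (Fin 3) ℝ) : coef K (ad X) = 0 := by
  rw [coef_apply, trace_ad_mul_perp, mul_zero]

/-- The transpose of `lie_e_perp`: at most one basis vector is mapped to a nonzero multiple of `perp
K`, so a coordinate of the bracket involves a single coordinate of the argument. -/
lemma coef_lie_e_perp (i : Fin 3) (K L : Fin 20) :
    coef K ⁅ad (e i).1, perp L⁆ = if L = eBack i K then (eBackScal i K : ℝ) / 6 else 0 := by
  have h : ∀ i K L, (if eShift i L = K then eScal i L else 0) =
      if L = eBack i K then eBackScal i K else 0 := by decide +kernel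
  have h' := congrArg (fun x : ℤ => (x : ℝ) / 6) (h i K L)
  rw [lie_e_perp, map_smul, coef_perp, smul_eq_mul]
  split_ifs at h' ⊢ <;> first | (simp; done) | simpa using h'

lemma coef_lie_eCheck_perp (i : Fin 3) (K L : Fin 20) :
    coef K ⁅ad (eCheck i).1, perp L⁆ =
      if L = eCheckBack i K then (eCheckBackScal i K : ℝ) / 6 else 0 := by
  have h : ∀ i K L, (if eCheckShift i L = K then eCheckScal i L else 0) =
      if L = eCheckBack i K then eCheckBackScal i K else 0 := by decide +kernel
  have h' := congrArg (fun x : ℤ => (x : ℝ) / 6) (h i K L)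
  rw [lie_eCheck_perp, map_smul, coef_perp, smul_eq_mul]
  split_ifs at h' ⊢ <;> first | (simp; done) | simpa using h'

/-- The linear forms `e_i*` on the component in `𝔤`. -/
lemma eStar_prG (i : Fin 3) (X : Mat8) : eStar i (prG X) = (X * ad (eCheck i).1).trace / 6 := by
  fin_cases i <;> rfl

lemma prG_perp (K : Fin 20) : prG (perp K) = 0 := by
  ext i j
  change (perp K * ad (Matrix.single j i 1)).trace / 6 = 0
  rw [Matrix.trace_mul_comm, trace_ad_mul_perp, zero_div]

/-! ### The decomposition `𝔩 = 𝔤 ⊕ 𝔤^⊥` -/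

lemma trace_cst_single_mul (a b : Fin 8) (X : Matrix (Fin 8) (Fin 8) ℤ) :
    (Matrix.single a b (1 : ℝ) * cst X).trace = X b a := by
  rw [Matrix.trace_mul_comm, Matrix.trace_mul_single]
  simp [cst]

lemma kappa_eq : kappa = cst kappaZ := by
  have h : (Matrix.of fun i j => (adZ (AZ i) * adZ (AZ j)).trace) = kappaZ := by decide +kernel
  ext i j
  rw [← h]
  simp only [kappa, Matrix.of_apply, A_eq, ad_cast, cst_mul, cst_trace]
  rfl

lemma kappaInv_mul_kappa : cst kappaInvZ * kappa = (18 : ℝ) • (1 : Mat8) := by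
  have h : ∀ i j, (kappaInvZ * kappaZ) i j = if i = j then 18 else 0 := by decide +kernel
  rw [kappa_eq, cst_mul]
  ext i j
  simp only [cst, Matrix.map_apply, h, Matrix.smul_apply, Matrix.one_apply, smul_eq_mul]
  split_ifs <;> simp

/-- The completeness relation `8 + 20 = 28 = dim 𝔬(5,3)`, tested on the matrix units and multiplied
by 144 to be integral: `24 = 144/6`, `72 = 144/2`, `4 = 144/36`. -/
lemma ad_sum_add_perp_sum : ∀ a b c d : Fin 8,
    24 * ∑ i : Fin 3, ∑ j : Fin 3,
      adZ (Matrix.single j i 1) b a * adZ (Matrix.single i j 1) c d +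
    ∑ K, (144 / normZ K) * perpZ (K + 10) b a * perpZ K c d =
    72 * (if a = c ∧ b = d then 1 else 0) - 4 * (kappaInvZ c b * kappaZ a d) := by
  decide +kernel

/-- The sum of the projections to `𝔤` and to `𝔤^⊥` is the projection of `𝔤𝔩(V)` to `𝔬(V, κ)`. -/
lemma ad_prG_add_sum_coef (X : Mat8) : ad (prG X).1 + ∑ K, coef K X • perp K =
    (1 / 2 : ℝ) • X - (1 / 36 : ℝ) • (cst kappaInvZ * X.transpose * kappa) := by
  let f : Mat8 →ₗ[ℝ] Mat8 := adL ∘ₗ (LieAlgebra.SpecialLinear.sl (Fin 3) ℝ).toSubmodule.subtype ∘ₗ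
    prG + ∑ K, (coef K).smulRight (perp K)
  let f' : Mat8 →ₗ[ℝ] Mat8 := (1 / 2 : ℝ) • LinearMap.id - (1 / 36 : ℝ) •
    (LinearMap.mulRight ℝ kappa ∘ₗ LinearMap.mulLeft ℝ (cst kappaInvZ) ∘ₗ
      (Matrix.transposeLinearEquiv (Fin 8) (Fin 8) ℝ ℝ).toLinearMap)
  have key : f = f' := by
    -- Both sides are linear in `X`, so it suffices to compare them on matrix units.
    refine Matrix.ext_linearMap ℝ fun a b => LinearMap.ext_ring ?_
    have hf : f (Matrix.single a b 1) = ∑ i, ∑ j,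
        ((adZ (Matrix.single j i 1) b a : ℝ) / 6) • cst (adZ (Matrix.single i j 1)) +
          ∑ K, ((normZ K : ℝ)⁻¹ * perpZ (K + 10) b a) • perp K := by
      have h1 : ad (prG (Matrix.single a b 1)).1 = ∑ i, ∑ j,
          ((adZ (Matrix.single j i 1) b a : ℝ) / 6) • cst (adZ (Matrix.single i j 1)) := by
        rw [ad_sum]
        refine Finset.sum_congr rfl fun i _ => Finset.sum_congr rfl fun j _ => ?_
        rw [← ad_single, ← trace_cst_single_mul a b, ← ad_single]
        rfl
      have h2 : ∀ K, coef K (Matrix.single a b 1) = (normZ K : ℝ)⁻¹ * perpZ (K + 10) b a :=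
        fun K => by rw [coef_apply, perp, trace_cst_single_mul]
      simp only [← h1, ← h2]
      simp [f, adL, LinearMap.sum_apply]
    have hf' : f' (Matrix.single a b 1) = (1 / 2 : ℝ) • Matrix.single a b 1 - (1 / 36 : ℝ) •
        (cst kappaInvZ * (cst (Matrix.single b a 1) * cst kappaZ)) := by
      have h1 : (Matrix.single a b (1 : ℝ)).transpose = cst (Matrix.single b a 1) := by
        rw [Matrix.transpose_single, cst, Matrix.map_single]
        simp
      simp [f', h1, kappa_eq, Matrix.mul_assoc]
    change f (Matrix.single a b 1) = f' (Matrix.single a b 1)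
    rw [hf, hf', cst_mul, cst_mul]
    ext c d
    have hn : ∀ K, ((144 / normZ K : ℤ) : ℝ) = 144 * (normZ K : ℝ)⁻¹ := by
      intro K
      have h : ∀ K, 144 / normZ K * normZ K = 144 := by decide +kernel
      have h' : ((144 / normZ K : ℤ) : ℝ) * normZ K = 144 := by exact_mod_cast h K
      rw [← h', mul_inv_cancel_right₀ (normZ_ne_zero K)]
    have h := congrArg (fun x : ℤ => (x : ℝ)) (ad_sum_add_perp_sum a b c d)
    have h3 : (kappaInvZ * (Matrix.single b a 1 * kappaZ) : Matrix _ _ ℤ) c d =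
        kappaInvZ c b * kappaZ a d := by
      rw [Matrix.mul_apply, Finset.sum_eq_single b]
      · simp
      · intro x _ hx
        simp [hx]
      · simp
    simp only [Int.cast_add, Int.cast_mul, Int.cast_sub, Int.cast_sum, Int.cast_ofNat, hn] at h
    simp only [Matrix.add_apply, Matrix.sum_apply, Matrix.smul_apply, Matrix.sub_apply, perp,
      cst, Matrix.map_apply, h3, smul_eq_mul, eq_intCast, Int.cast_mul, Matrix.single_apply]
    have e1 : ∀ x y : ℝ, x / 6 * y = 24 * (x * y) / 144 := fun x y => by ring
    have e2 : ∀ x y w : ℝ, x * y * w = 144 * x * y * w / 144 := fun x y w => by ring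
    simp only [e1]
    simp only [e2 (normZ _ : ℝ)⁻¹]
    simp only [← Finset.sum_div, ← Finset.mul_sum]
    rw [← add_div, div_eq_iff (by norm_num)]
    simp only [Finset.mul_sum] at h ⊢
    rw [h]
    split_ifs <;> push_cast <;> ring
  have h := LinearMap.congr_fun key X
  simpa [f, f', adL, LinearMap.sum_apply] using h

/-- The projection `X ↦ (X - κ⁻¹ Xᵀ κ)/2` fixes skew-adjoint matrices; `kappaInvZ` is `18 κ⁻¹`,
whence the constant `1/36` used above. -/
lemma eq_ad_prG_add_sum {X : Mat8} (hX : X ∈ l) :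
    X = ad (prG X).1 + ∑ K, coef K X • perp K := by
  have h : X.transpose * kappa = -(kappa * X) := by
    have h := (mem_skewAdjointMatricesLieSubalgebra kappa X).1 hX
    simpa [Matrix.IsSkewAdjoint, Matrix.IsAdjointPair] using h
  rw [ad_prG_add_sum_coef, Matrix.mul_assoc, h, Matrix.mul_neg, ← Matrix.mul_assoc,
    kappaInv_mul_kappa]
  ext i j
  simp
  ring

/-! ### Degrees -/

/-- Homogeneous elements of degree `d` of `𝔤𝔩(V)`. -/
def IsDeg (d : ℤ) (X : Mat8) : Prop := ∀ a b, X a b ≠ 0 → degA a - degA b = d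

lemma isDeg_cst {d : ℤ} {X : Matrix (Fin 8) (Fin 8) ℤ}
    (h : ∀ a b, (X a b).natAbs ≠ 0 → degA a - degA b = d) : IsDeg d (cst X) := fun a b hab =>
  h a b fun h0 => hab (by simp [cst, Int.natAbs_eq_zero.1 h0])

lemma IsDeg.mul {c d : ℤ} {X Y : Mat8} (hX : IsDeg c X) (hY : IsDeg d Y) :
    IsDeg (c + d) (X * Y) := by
  intro a b hab
  rw [Matrix.mul_apply] at hab
  obtain ⟨k, -, hk⟩ := Finset.exists_ne_zero_of_sum_ne_zero hab
  have h1 := hX a k (left_ne_zero_of_mul hk)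
  have h2 := hY k b (right_ne_zero_of_mul hk)
  omega

lemma IsDeg.sub {d : ℤ} {X Y : Mat8} (hX : IsDeg d X) (hY : IsDeg d Y) : IsDeg d (X - Y) := by
  intro a b hab
  by_cases h : X a b = 0
  · exact hY a b fun h' => hab (by simp [h, h'])
  · exact hX a b h

lemma IsDeg.lie {c d : ℤ} {X Y : Mat8} (hX : IsDeg c X) (hY : IsDeg d Y) :
    IsDeg (c + d) ⁅X, Y⁆ := by
  rw [Ring.lie_def]
  exact (hX.mul hY).sub (add_comm d c ▸ hY.mul hX)

lemma IsDeg.trace_eq_zero {d : ℤ} {X : Mat8} (hX : IsDeg d X) (hd : d ≠ 0) : X.trace = 0 := by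
  refine Finset.sum_eq_zero fun a _ => ?_
  by_contra h
  exact hd (by rw [← hX a a h, sub_self])

lemma isDeg_perp (K : Fin 20) : IsDeg (degPerp K) (perp K) := by
  have h : ∀ K a b, (perpZ K a b).natAbs ≠ 0 → degA a - degA b = degPerp K := by decide +kernel
  exact isDeg_cst (h K)

lemma isDeg_ad_eCheck (i : Fin 3) : IsDeg (-degE i) (ad (eCheck i).1) := by
  have h : ∀ i a b, (adECheckZ i a b).natAbs ≠ 0 → degA a - degA b = -degE i := by decide +kernel
  rw [ad_eCheck]
  exact isDeg_cst (h i)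

lemma degPerp_add_ten (K : Fin 20) : degPerp (K + 10) = -degPerp K := by
  revert K
  decide +kernel

lemma coef_lie_perp_perp_of_degPerp_ne {K L M : Fin 20} (h : degPerp L + degPerp M ≠ degPerp K) :
    coef K ⁅perp L, perp M⁆ = 0 := by
  rw [coef_apply, (((isDeg_perp L).lie (isDeg_perp M)).mul (isDeg_perp (K + 10))).trace_eq_zero,
    mul_zero]
  rw [degPerp_add_ten]
  omega

lemma eStar_prG_lie_perp_perp_of_degPerp_ne {i : Fin 3} {L M : Fin 20}
    (h : degPerp L + degPerp M ≠ degE i) : eStar i (prG ⁅perp L, perp M⁆) = 0 := by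
  rw [eStar_prG, (((isDeg_perp L).lie (isDeg_perp M)).mul (isDeg_ad_eCheck i)).trace_eq_zero,
    zero_div]
  omega

lemma degPart_perp (d : ℤ) (K : Fin 20) :
    degPart d (perp K) = if degPerp K = d then perp K else 0 := by
  ext a b
  rw [degPart, Matrix.of_apply]
  by_cases h : perp K a b = 0
  · simp only [h, ite_self]
    split_ifs <;> simp [h]
  · rw [isDeg_perp K a b h]
    split_ifs <;> rfl

/-! ### The brackets of the values of the structure function -/

/-- The positions of the coordinates of the structure function that do not vanish: those of
`R_{-1,1}, R_{0,1}, R_{1,1}, R_{2,1}` at `e₂, e₀` and of `S_{1,-1}, S_{1,0}, S_{1,1}, S_{1,2}`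
at `e₁, e₀`. -/
def Allowed (i : Fin 3) (K : Fin 20) : Prop :=
  (i ≠ 1 ∧ (K = 0 ∨ K = 1 ∨ K = 3 ∨ K = 6)) ∨ (i ≠ 2 ∧ (K = 16 ∨ K = 17 ∨ K = 18 ∨ K = 19))

instance (i : Fin 3) (K : Fin 20) : Decidable (Allowed i K) := by
  unfold Allowed
  infer_instance

lemma Allowed.degPerp_nonneg {i : Fin 3} {K : Fin 20} (h : Allowed i K) : 0 ≤ degPerp K := by
  revert i K
  decide +kernel

/-- The allowed `R` have weights `(a, 1)`, so a bracket of two of them has weight `(a + b, 2)`, and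
the only such weight in `𝔤^⊥` is that of `S_{1,2}`, of degree 3. Symmetrically, two allowed `S` only
reach `R_{2,1}`, and an allowed `R` and an allowed `S` bracket to something without `𝔤^⊥`-component.
-/
lemma coef_lie_perp_perp_of_allowed {i j : Fin 3} {K L M : Fin 20} (hij : i ≠ j)
    (hL : Allowed i L) (hM : Allowed j M) (hp : degPerp K - degE i - degE j ≤ 5) :
    coef K ⁅perp L, perp M⁆ = 0 := by
  by_cases hd : degPerp L + degPerp M = degPerp K
  swap
  · exact coef_lie_perp_perp_of_degPerp_ne hd
  have h1 : ∀ L, Allowed 0 L → ∀ M, Allowed 0 M → ∀ K, degPerp L + degPerp M = degPerp K →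
      (L < 10 ∧ M < 10 ∧ degPerp K = 3) ∨ (10 ≤ L ∧ 10 ≤ M ∧ degPerp K = 3) ∨
        ((perpZ L * perpZ M - perpZ M * perpZ L) * perpZ (K + 10)).trace = 0 := by
    decide +kernel
  have h2 : ∀ i L, Allowed i L → Allowed 0 L := by decide +kernel
  -- Two allowed vectors of the same type at distinct arguments use `{e₀, e₂}` or `{e₀, e₁}`, of
  -- total degree `-3`. A contribution in degree 3 would therefore belong to the equation of degree
  -- 6, beyond the bound 5.
  have h3 : ∀ i j, i ≠ j → ∀ L, Allowed i L → ∀ M, Allowed j M →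
      (L < 10 ∧ M < 10) ∨ (10 ≤ L ∧ 10 ≤ M) → degE i + degE j = -3 := by decide +kernel
  have h4 := h3 i j hij L hL M hM
  obtain h | h | h := h1 L (h2 i L hL) M (h2 j M hM) K hd
  · have := h4 (.inl ⟨h.1, h.2.1⟩)
    omega
  · have := h4 (.inr ⟨h.1, h.2.1⟩)
    omega
  · rw [coef_apply, perp, perp, perp, cst_lie, cst_mul, cst_trace, h, Int.cast_zero, mul_zero]

/-- The element of `𝔤^⊥` with given coordinates. -/
def perpSum (x : Fin 20 → ℝ) : Mat8 := ∑ K, x K • perp K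

lemma coef_perpSum (x : Fin 20 → ℝ) (K : Fin 20) : coef K (perpSum x) = x K := by
  simp [perpSum, coef_perp]

lemma lie_perpSum (X : Mat8) (x : Fin 20 → ℝ) : ⁅X, perpSum x⁆ = ∑ L, x L • ⁅X, perp L⁆ := by
  simp only [perpSum, Ring.lie_def, Finset.mul_sum, Finset.sum_mul, Matrix.mul_smul,
    Matrix.smul_mul, smul_sub, Finset.sum_sub_distrib]

lemma perpSum_lie (X : Mat8) (x : Fin 20 → ℝ) : ⁅perpSum x, X⁆ = ∑ L, x L • ⁅perp L, X⁆ := by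
  simp only [perpSum, Ring.lie_def, Finset.mul_sum, Finset.sum_mul, Matrix.mul_smul,
    Matrix.smul_mul, smul_sub, Finset.sum_sub_distrib]

lemma coef_lie_e_perpSum (i : Fin 3) (x : Fin 20 → ℝ) (K : Fin 20) :
    coef K ⁅ad (e i).1, perpSum x⁆ = eBackScal i K / 6 * x (eBack i K) := by
  simp [lie_perpSum, coef_lie_e_perp, mul_comm]

lemma prG_lie_e_perpSum (i : Fin 3) (x : Fin 20 → ℝ) : prG ⁅ad (e i).1, perpSum x⁆ = 0 := by
  simp [lie_perpSum, lie_e_perp, prG_perp]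

lemma coef_lie_eCheck_perpSum (i : Fin 3) (x : Fin 20 → ℝ) (K : Fin 20) :
    coef K ⁅ad (eCheck i).1, perpSum x⁆ = eCheckBackScal i K / 6 * x (eCheckBack i K) := by
  simp [lie_perpSum, coef_lie_eCheck_perp, mul_comm]

lemma lie_perpSum_perpSum (x y : Fin 20 → ℝ) :
    ⁅perpSum x, perpSum y⁆ = ∑ L, ∑ M, (x L * y M) • ⁅perp L, perp M⁆ := by
  simp only [perpSum_lie, lie_perpSum (perp _), Finset.smul_sum, smul_smul]

section Nonlinear

variable {x : Fin 3 → Fin 20 → ℝ} {p : ℤ} {i j : Fin 3} {K : Fin 20}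

/-- The degrees of the two factors add up to `p` and both are positive, so both are less than `p`
and the induction hypothesis confines the factors to allowed positions. -/
lemma coef_lie_perpSum_perpSum (hpos : ∀ j K, degPerp K - degE j ≤ 0 → x j K = 0)
    (hlt : ∀ j K, degPerp K - degE j < p → ¬ Allowed j K → x j K = 0) (hij : i ≠ j) (hp : p ≤ 5)
    (hK : degPerp K - degE i - degE j = p) : coef K ⁅perpSum (x i), perpSum (x j)⁆ = 0 := by
  simp only [lie_perpSum_perpSum, map_sum, map_smul, smul_eq_mul]
  refine Finset.sum_eq_zero fun L _ => Finset.sum_eq_zero fun M _ => ?_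
  by_cases hL0 : x i L = 0
  · rw [hL0, zero_mul, zero_mul]
  by_cases hM0 : x j M = 0
  · rw [hM0, mul_zero, zero_mul]
  by_cases hd : degPerp L + degPerp M = degPerp K
  swap
  · rw [coef_lie_perp_perp_of_degPerp_ne hd, mul_zero]
  have hL1 : 0 < degPerp L - degE i := not_le.1 fun h => hL0 (hpos i L h)
  have hM1 : 0 < degPerp M - degE j := not_le.1 fun h => hM0 (hpos j M h)
  have hL2 : Allowed i L := not_not.1 fun h => hL0 (hlt i L (by omega) h)
  have hM2 : Allowed j M := not_not.1 fun h => hM0 (hlt j M (by omega) h)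
  rw [coef_lie_perp_perp_of_allowed hij hL2 hM2 (hK.trans_le hp), mul_zero]

/-- Here three positive degrees add up to `p`, so again all are below `p`. Allowed vectors have
nonnegative degree, hence their bracket has no component in `𝔤₋`. -/
lemma eStar_prG_lie_perpSum_perpSum_mul (hpos : ∀ j K, degPerp K - degE j ≤ 0 → x j K = 0)
    (hlt : ∀ j K, degPerp K - degE j < p → ¬ Allowed j K → x j K = 0)
    (hK : degPerp K - degE i - degE j = p) (m : Fin 3) :
    eStar m (prG ⁅perpSum (x i), perpSum (x j)⁆) * x m K = 0 := by
  simp only [lie_perpSum_perpSum, map_sum, map_smul, smul_eq_mul, Finset.sum_mul]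
  refine Finset.sum_eq_zero fun L _ => Finset.sum_eq_zero fun M _ => ?_
  by_cases hL0 : x i L = 0
  · rw [hL0, zero_mul, zero_mul, zero_mul]
  by_cases hM0 : x j M = 0
  · rw [hM0, mul_zero, zero_mul, zero_mul]
  by_cases hK0 : x m K = 0
  · rw [hK0, mul_zero]
  by_cases hd : degPerp L + degPerp M = degE m
  swap
  · rw [eStar_prG_lie_perp_perp_of_degPerp_ne hd, mul_zero, zero_mul]
  have hm : degE m < 0 := (by decide : ∀ m, degE m < 0) m
  have hL1 : 0 < degPerp L - degE i := not_le.1 fun h => hL0 (hpos i L h)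
  have hM1 : 0 < degPerp M - degE j := not_le.1 fun h => hM0 (hpos j M h)
  have hK1 : 0 < degPerp K - degE m := not_le.1 fun h => hK0 (hpos m K h)
  have hL2 : Allowed i L := not_not.1 fun h => hL0 (hlt i L (by omega) h)
  have hM2 : Allowed j M := not_not.1 fun h => hM0 (hlt j M (by omega) h)
  have := hL2.degPerp_nonneg
  have := hM2.degPerp_nonneg
  omega

end Nonlinear

/-! ### The linear part of the structure equation -/

/-- The structure constants of `𝔤₋`: `[e i, e j]` is a multiple of `e 0`. -/
def lieScal (i j : Fin 3) : ℤ := if i = 1 ∧ j = 2 then -1 else if i = 2 ∧ j = 1 then 1 else 0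

lemma lie_e_e (i j : Fin 3) : ⁅ad (e i).1, ad (e j).1⁆ = (lieScal i j : ℝ) • ad (e 0).1 := by
  have h : ∀ i j, adEZ i * adEZ j - adEZ j * adEZ i = lieScal i j • adEZ 0 := by decide +kernel
  rw [ad_e, ad_e, ad_e, cst_lie, h, cst_smul]

lemma lie_add_perpSum (x : Fin 3 → Fin 20 → ℝ) (i j : Fin 3) :
    ⁅ad (e i).1 + perpSum (x i), ad (e j).1 + perpSum (x j)⁆ =
      (lieScal i j : ℝ) • ad (e 0).1 + ⁅ad (e i).1, perpSum (x j)⁆ - ⁅ad (e j).1, perpSum (x i)⁆ +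
        ⁅perpSum (x i), perpSum (x j)⁆ := by
  rw [← lie_e_e]
  simp only [Ring.lie_def]
  noncomm_ring

/-- The part of degree `p ≤ 5` of the structure equation is linear, if the coordinates of lower
degree vanish outside of the allowed positions. -/
lemma linear_structure_eq {x : Fin 3 → Fin 20 → ℝ} {p : ℤ}
    (hpos : ∀ j K, degPerp K - degE j ≤ 0 → x j K = 0)
    (hlt : ∀ j K, degPerp K - degE j < p → ¬ Allowed j K → x j K = 0) (hp : p ≤ 5)
    {i j : Fin 3} (hij : i ≠ j) {K : Fin 20} (hK : degPerp K - degE i - degE j = p)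
    {d : Fin 3 → Fin 3 → Fin 20 → ℝ}
    (hd : d i j K - d j i K -
      ∑ m, eStar m (prG ⁅ad (e i).1 + perpSum (x i), ad (e j).1 + perpSum (x j)⁆) * x m K +
      coef K ⁅ad (e i).1 + perpSum (x i), ad (e j).1 + perpSum (x j)⁆ = 0) :
    d i j K - d j i K - lieScal i j * x 0 K + eBackScal i K / 6 * x j (eBack i K) -
      eBackScal j K / 6 * x i (eBack j K) = 0 := by
  have h1 : ∑ m, eStar m (prG ⁅ad (e i).1 + perpSum (x i), ad (e j).1 + perpSum (x j)⁆) * x m K =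
      lieScal i j * x 0 K := by
    simp only [lie_add_perpSum, map_add, map_sub, map_smul, prG_lie_e_perpSum, prG_ad, add_mul,
      eStar_prG_lie_perpSum_perpSum_mul hpos hlt hK, eStar_e]
    simp
  rw [h1, lie_add_perpSum, map_add, map_sub, map_add, map_smul, coef_ad,
    coef_lie_perpSum_perpSum hpos hlt hij hp hK, coef_lie_e_perpSum, coef_lie_e_perpSum] at hd
  rw [← hd]
  simp
  ring

/-! ### Smoothness of fields with constant components in a smooth coframe -/

lemma contMDiffAt_matrix_det {N : Type*} [TopologicalSpace N]
    [ChartedSpace (EuclideanSpace ℝ (Fin 8)) N] {ι : Type*} [Fintype ι] [DecidableEq ι]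
    {m : N → Matrix ι ι ℝ} {z : N}
    (h : ∀ i j, ContMDiffAt (𝓡 8) 𝓘(ℝ, ℝ) ∞ (fun w => m w i j) z) :
    ContMDiffAt (𝓡 8) 𝓘(ℝ, ℝ) ∞ (fun w => (m w).det) z := by
  simp only [Matrix.det_apply']
  refine ContMDiffAt.sum fun σ _ => ?_
  exact contMDiffAt_const.mul (ContMDiffAt.prod fun i _ => h _ _)

/-- A vector field on which the members of a smooth coframe are constant is smooth. -/
lemma isSmoothField_of_coframe {P : Type*} [TopologicalSpace P]
    [ChartedSpace (EuclideanSpace ℝ (Fin 8)) P] [IsManifold (𝓡 8) ∞ P]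
    (φ : Fin 8 → ∀ z : P, TangentSpace (𝓡 8) z →ₗ[ℝ] ℝ)
    (hφ : ∀ a, ContMDiff (𝓡 8).tangent 𝓘(ℝ, ℝ) ∞
      (fun v : TangentBundle (𝓡 8) P => φ a v.proj v.snd))
    (hinj : ∀ z v, (∀ a, φ a z v = 0) → v = 0)
    (X : ∀ z : P, TangentSpace (𝓡 8) z) (c : Fin 8 → ℝ) (hX : ∀ z a, φ a z (X z) = c a) :
    IsSmoothField X := by
  intro z₀
  let t := trivializationAt (EuclideanSpace ℝ (Fin 8)) (TangentSpace (𝓡 8) : P → Type _) z₀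
  let b := (EuclideanSpace.basisFun (Fin 8) ℝ).toBasis
  have hz₀ : z₀ ∈ t.baseSet := FiberBundle.mem_baseSet_trivializationAt' z₀
  let m : P → Matrix (Fin 8) (Fin 8) ℝ := fun z => Matrix.of fun a i => φ a z (t.localFrame b i z)
  have hm : ∀ a i, ContMDiffAt (𝓡 8) 𝓘(ℝ, ℝ) ∞ (fun z => m z a i) z₀ := fun a i =>
    ((hφ a).contMDiffAt (x := ⟨z₀, t.localFrame b i z₀⟩)).comp z₀
      (contMDiffAt_localFrame_of_mem ∞ t b i hz₀)
  let y : P → Fin 8 → ℝ := fun z i => t.localFrameCoeff (𝓡 8) b i z (X z)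
  have hsum : ∀ z ∈ t.baseSet, ∀ u : Fin 8 → ℝ, ∀ a,
      (m z).mulVec u a = φ a z (∑ i, u i • t.localFrame b i z) := by
    intro z _ u a
    simp only [Matrix.mulVec, dotProduct, m, Matrix.of_apply, map_sum, map_smul, smul_eq_mul]
    exact Finset.sum_congr rfl fun i _ => mul_comm _ _
  have hker : ∀ z ∈ t.baseSet, ∀ u, (m z).mulVec u = 0 → u = 0 := by
    intro z hz u hu
    have h0 := hinj z (∑ i, u i • t.localFrame b i z) fun a => by
      rw [← hsum z hz u a, hu, Pi.zero_apply]
    have hli := (t.isLocalFrameOn_localFrame_baseSet (𝓡 8) ∞ b).linearIndependent hz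
    ext i
    exact Fintype.linearIndependent_iff.1 hli u h0 i
  have hdet : ∀ z ∈ t.baseSet, (m z).det ≠ 0 := by
    intro z hz h
    obtain ⟨u, hu, hu'⟩ := Matrix.exists_mulVec_eq_zero_iff.2 h
    exact hu (hker z hz u hu')
  -- Cramer's rule expresses the components of `X` in a local frame as rational functions of the
  -- smooth entries of `m`, with denominator vanishing nowhere on the base set.
  have hy : ∀ z ∈ t.baseSet, ∀ i, y z i = ((m z).det)⁻¹ * ((m z).updateCol i c).det := by
    intro z hz i
    have h1 : (m z).mulVec (y z) = c := by
      ext a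
      rw [hsum z hz, ← hX z a]
      exact congrArg _ (t.eq_sum_localFrameCoeff_smul (I := 𝓡 8) (b := b) (s := X) hz).symm
    have h2 : Matrix.cramer (m z) c - (m z).det • y z = 0 := by
      refine hker z hz _ ?_
      rw [Matrix.mulVec_sub, Matrix.mulVec_cramer, Matrix.mulVec_smul, h1, sub_self]
    have h3 := congrFun (sub_eq_zero.1 h2) i
    rw [Matrix.cramer_apply] at h3
    rw [h3, Pi.smul_apply, smul_eq_mul, inv_mul_cancel_left₀ (hdet z hz)]
  refine (contMDiffAt_iff_localFrameCoeff (I := 𝓡 8) (e := t) (s := X) b hz₀).2 fun i => ?_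
  have hsm : ContMDiffAt (𝓡 8) 𝓘(ℝ, ℝ) ∞
      (fun z => ((m z).det)⁻¹ * ((m z).updateCol i c).det) z₀ := by
    refine ((contMDiffAt_matrix_det hm).inv₀ (hdet z₀ hz₀)).mul (contMDiffAt_matrix_det ?_)
    intro a j
    simp only [Matrix.updateCol_apply]
    split_ifs
    · exact contMDiffAt_const
    · exact hm a j
  refine hsm.congr_of_eventuallyEq ?_
  filter_upwards [t.open_baseSet.mem_nhds hz₀] with z hz
  exact hy z hz i

/-! ### Derivatives along vector fields -/

section DerivAlong

variable {P : Type*} [TopologicalSpace P] [ChartedSpace (EuclideanSpace ℝ (Fin 8)) P]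
  (X : ∀ z : P, TangentSpace (𝓡 8) z)

lemma derivAlong_const (c : ℝ) (z : P) : derivAlong X (fun _ => c) z = 0 := by
  rw [derivAlong, mfderiv_const]
  rfl

lemma derivAlong_const_mul (c : ℝ) {f : P → ℝ} (hf : ContMDiff (𝓡 8) 𝓘(ℝ, ℝ) ∞ f) (z : P) :
    derivAlong X (fun w => c * f w) z = c * derivAlong X f z := by
  have h := const_smul_mfderiv (hf.mdifferentiable (by simp) z) c
  exact congrArg (fun L => L (X z)) h

lemma derivAlong_add {f f' : P → ℝ} (hf : ContMDiff (𝓡 8) 𝓘(ℝ, ℝ) ∞ f)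
    (hf' : ContMDiff (𝓡 8) 𝓘(ℝ, ℝ) ∞ f') (z : P) :
    derivAlong X (fun w => f w + f' w) z = derivAlong X f z + derivAlong X f' z := by
  have h := mfderiv_add (hf.mdifferentiable (by simp) z) (hf'.mdifferentiable (by simp) z)
  exact congrArg (fun L => L (X z)) h

lemma derivAlong_sum {ι : Type*} (s : Finset ι) {f : ι → P → ℝ}
    (hf : ∀ i, ContMDiff (𝓡 8) 𝓘(ℝ, ℝ) ∞ (f i)) (z : P) :
    derivAlong X (fun w => ∑ i ∈ s, f i w) z = ∑ i ∈ s, derivAlong X (f i) z := by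
  classical
  induction s using Finset.induction_on with
  | empty => simpa using derivAlong_const X 0 z
  | insert a s ha ih =>
    simp only [Finset.sum_insert ha]
    rw [derivAlong_add X (hf a) (contMDiff_finsetSum fun i _ => hf i), ih]

lemma derivAlong_sum_sum_mul {ι κ : Type*} (s : Finset ι) (t : Finset κ) (c : ι → κ → ℝ)
    {f : ι → κ → P → ℝ} (hf : ∀ i j, ContMDiff (𝓡 8) 𝓘(ℝ, ℝ) ∞ (f i j)) (z : P) :
    derivAlong X (fun w => ∑ i ∈ s, ∑ j ∈ t, c i j * f i j w) z =
      ∑ i ∈ s, ∑ j ∈ t, c i j * derivAlong X (f i j) z := by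
  have h : ∀ i j, ContMDiff (𝓡 8) 𝓘(ℝ, ℝ) ∞ (fun w => c i j * f i j w) := fun i j =>
    contMDiff_const.mul (hf i j)
  rw [derivAlong_sum X s fun i => contMDiff_finsetSum fun j _ => h i j]
  refine Finset.sum_congr rfl fun i _ => ?_
  rw [derivAlong_sum X t fun j => h i j]
  exact Finset.sum_congr rfl fun j _ => derivAlong_const_mul X _ (hf i j) z

/-- This gives smoothness of the iterated derivatives of `h`: each of those differentiated again is
a nonzero constant times a coordinate of `χ`, and these are smooth. -/
lemma contMDiff_of_const_mul {c : ℝ} (hc : c ≠ 0) {f f' : P → ℝ}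
    (hf : ContMDiff (𝓡 8) 𝓘(ℝ, ℝ) ∞ f) (h : f = fun z => c * f' z) :
    ContMDiff (𝓡 8) 𝓘(ℝ, ℝ) ∞ f' := by
  have h' : f' = fun z => c⁻¹ * f z := by
    ext z
    rw [h, inv_mul_cancel_left₀ hc]
  rw [h']
  exact contMDiff_const.mul hf

end DerivAlong

/-! ### Linear functions of matrices -/

lemma linear_apply_eq_sum (lam : Mat8 →ₗ[ℝ] ℝ) (X : Mat8) :
    lam X = ∑ i, ∑ j, lam (Matrix.single i j 1) * X i j := by
  conv_lhs => rw [Matrix.matrix_eq_sum_single X]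
  simp only [map_sum]
  refine Finset.sum_congr rfl fun i _ => Finset.sum_congr rfl fun j _ => ?_
  rw [mul_comm, ← smul_eq_mul, ← map_smul, Matrix.smul_single, smul_eq_mul, mul_one]

/-! ### One-parameter subgroups of `G⁰` -/

/-- A traceless diagonal matrix. -/
def diagG (a b : ℝ) : g := ⟨!![a, 0, 0; 0, b, 0; 0, 0, -(a + b)], by
  refine LinearMap.mem_ker.2 ?_
  rw [Matrix.traceLinearMap_apply, Matrix.trace_fin_three]
  simp⟩

/-- A strictly upper triangular matrix. -/
def upperG (w : Fin 3 → ℝ) : g := ⟨!![0, w 0, w 1; 0, 0, w 2; 0, 0, 0], by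
  refine LinearMap.mem_ker.2 ?_
  rw [Matrix.traceLinearMap_apply, Matrix.trace_fin_three]
  simp⟩

/-- The one-parameter subgroup generated by `diagG a b`. -/
def diagSubgroup (a b t : ℝ) : G0 :=
  G0.mk ((Units.mk0 _ (Real.exp_ne_zero (t * a)), Units.mk0 _ (Real.exp_ne_zero (t * b))), 0)

/-- The one-parameter subgroup generated by `upperG w`, if `w 0 * w 2 = 0`. -/
def upperSubgroup (w : Fin 3 → ℝ) (t : ℝ) : G0 := G0.mk ((1, 1), t • w)

lemma diagSubgroup_add (a b s t : ℝ) :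
    diagSubgroup a b (s + t) = diagSubgroup a b s * diagSubgroup a b t := by
  apply Subtype.ext
  apply Subtype.ext
  change _ = (diagSubgroup a b s).1.1 * (diagSubgroup a b t).1.1
  ext i j
  fin_cases i <;> fin_cases j <;>
    simp [diagSubgroup, G0.mk, Matrix.mul_apply, Fin.sum_univ_three, add_mul, Real.exp_add]
  ring

lemma upperSubgroup_add {w : Fin 3 → ℝ} (hw : w 0 * w 2 = 0) (s t : ℝ) :
    upperSubgroup w (s + t) = upperSubgroup w s * upperSubgroup w t := by
  apply Subtype.ext
  apply Subtype.ext
  change _ = (upperSubgroup w s).1.1 * (upperSubgroup w t).1.1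
  ext i j
  fin_cases i <;> fin_cases j <;>
    simp [upperSubgroup, G0.mk, Matrix.mul_apply, Fin.sum_univ_three]
  · ring
  -- The `E₁₃` entry of the product has the extra term `s t w₀ w₂`; without it the exponential of `t
  -- w` is `1 + t w`.
  · linear_combination -(s * t) * hw
  · ring

lemma diagSubgroup_apply (a b t : ℝ) : (diagSubgroup a b t).1.1 =
    !![Real.exp (t * a), 0, 0; 0, Real.exp (t * b), 0; 0, 0, Real.exp (t * -(a + b))] := by
  ext i j
  fin_cases i <;> fin_cases j <;> simp [diagSubgroup, G0.mk]
  rw [← Real.exp_neg, ← Real.exp_neg, ← Real.exp_add]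
  ring_nf

lemma upperSubgroup_apply (w : Fin 3 → ℝ) (t : ℝ) : (upperSubgroup w t).1.1 =
    !![1, t * w 0, t * w 1; 0, 1, t * w 2; 0, 0, 1] := by
  ext i j
  fin_cases i <;> fin_cases j <;> simp [upperSubgroup, G0.mk]

/-- The nilpotent part is split into an `E₁₂, E₁₃` part and an `E₂₃` part so that each satisfies `w
0 * w 2 = 0` and generates an explicit one-parameter group. -/
lemma eq_sum_add_diagG_add_upperG (x : g) : x = ∑ m, eStar m x • e m + (diagG (x.1 0 0) (x.1 1 1) +
    (upperG ![x.1 0 1, x.1 0 2, 0] + upperG ![0, 0, x.1 1 2])) := by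
  have h : x.1 0 0 + x.1 1 1 + x.1 2 2 = 0 := by
    have h := LinearMap.mem_ker.1 x.2
    rwa [Matrix.traceLinearMap_apply, Matrix.trace_fin_three] at h
  have h0 : ∀ m, eStar m x = x.1 (![2, 1, 2] m) (![0, 0, 1] m) := fun m => rfl
  apply Subtype.ext
  ext i j
  fin_cases i <;> fin_cases j <;>
    simp [Fin.sum_univ_three, h0, e, E, diagG, upperG]
  linarith

namespace ExtrinsicCartanConnection

variable {M P : Type*}
  [TopologicalSpace M] [ChartedSpace (EuclideanSpace ℝ (Fin 3)) M]
  [TopologicalSpace P] [ChartedSpace (EuclideanSpace ℝ (Fin 8)) P]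
  [IsManifold (𝓡 8) ∞ P] (C : ExtrinsicCartanConnection M P)

/-! ### The structure function in coordinates -/

lemma formI_apply (z : P) (v : TangentSpace (𝓡 8) z) : C.formI z v = prG (C.form z v) := rfl

lemma form_eq (z : P) (v : TangentSpace (𝓡 8) z) :
    C.form z v = ad (C.formI z v).1 + C.χ z (C.formI z v) := by
  have h : C.χ z (C.formI z v) = C.form z v - ad (C.formI z v).1 := by
    simp only [χ, LinearMap.comp_apply, LinearEquiv.coe_coe, LinearEquiv.symm_apply_apply]
    rfl
  rw [h]
  abel

lemma χ_eq_perpSum (z : P) (x : g) : C.χ z x = perpSum fun K => coef K (C.χ z x) := by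
  obtain ⟨v, rfl⟩ := (C.formI z).surjective x
  have h1 := C.form_eq z v
  have h2 := eq_ad_prG_add_sum (C.form_mem z v)
  rw [← formI_apply] at h2
  have h3 : C.χ z (C.formI z v) = ∑ K, coef K (C.form z v) • perp K :=
    add_left_cancel (h1.symm.trans h2)
  have h4 : ∀ K, coef K (C.form z v) = coef K (C.χ z (C.formI z v)) := fun K => by
    rw [h1, map_add, coef_ad, zero_add]
  simp only [h4] at h3
  exact h3

/-- On the fundamental field of `Y`, the form `ω` equals `ad Y`, which lies in `𝔤`; so `ω_I` is `Y`
and `ω_II` is 0. -/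
lemma χ_eq_zero_of_oneParam (z : P) (c : ℝ → G0) (hc : ∀ s t, c (s + t) = c s * c t)
    (hs : ∀ i j, ContDiff ℝ ∞ (fun t => (c t).1.1 i j)) (Y : g)
    (hY : ∀ i j, deriv (fun t => (c t).1.1 i j) 0 = Y.1 i j) : C.χ z Y = 0 := by
  have h0 : c 0 = 1 := by
    have h := hc 0 0
    rw [add_zero] at h
    exact left_eq_mul.1 h
  have h1 := C.form_fundamental z c hc hs
  have h2 : (Matrix.of fun i j => deriv (fun t => (c t).1.1 i j) 0) = Y.1 := by
    ext i j
    exact hY i j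
  rw [h2] at h1
  have h3 : C.χ (C.act z (c 0)) Y = 0 := by
    have h4 := C.form_eq (C.act z (c 0))
      (mfderiv 𝓘(ℝ, ℝ) (𝓡 8) (fun t : ℝ => C.act z (c t)) 0 (1 : ℝ))
    rw [formI_apply, h1, prG_ad] at h4
    exact left_eq_add.1 h4
  rwa [h0, C.act_one] at h3

lemma χ_diagG (z : P) (a b : ℝ) : C.χ z (diagG a b) = 0 := by
  refine C.χ_eq_zero_of_oneParam z (diagSubgroup a b) (diagSubgroup_add a b) ?_ _ ?_
  · intro i j
    simp only [diagSubgroup_apply]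
    fin_cases i <;> fin_cases j <;> simp <;> fun_prop
  · intro i j
    simp only [diagSubgroup_apply]
    fin_cases i <;> fin_cases j <;> simp [diagG, -mul_neg, -neg_add_rev]

lemma χ_upperG (z : P) {w : Fin 3 → ℝ} (hw : w 0 * w 2 = 0) : C.χ z (upperG w) = 0 := by
  refine C.χ_eq_zero_of_oneParam z (upperSubgroup w) (upperSubgroup_add hw) ?_ _ ?_
  · intro i j
    simp only [upperSubgroup_apply]
    fin_cases i <;> fin_cases j <;> simp <;> fun_prop
  · intro i j
    simp only [upperSubgroup_apply]
    fin_cases i <;> fin_cases j <;> simp [upperG]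

/-- The structure function vanishes on `𝔤⁰`. -/
lemma χ_apply (z : P) (x : g) : C.χ z x = ∑ m, eStar m x • C.χ z (e m) := by
  conv_lhs => rw [eq_sum_add_diagG_add_upperG x]
  simp only [map_add, map_sum, map_smul]
  rw [χ_diagG, χ_upperG, χ_upperG] <;> simp

/-- The coordinates of the structure function. -/
def coord (j : Fin 3) (K : Fin 20) (z : P) : ℝ := coef K (C.χ z (e j))

lemma χ_e (z : P) (j : Fin 3) : C.χ z (e j) = perpSum fun K => C.coord j K z :=
  C.χ_eq_perpSum z (e j)

/-! ### Smoothness -/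

lemma contMDiff_linear_form (lam : Mat8 →ₗ[ℝ] ℝ) : ContMDiff (𝓡 8).tangent 𝓘(ℝ, ℝ) ∞
    (fun v : TangentBundle (𝓡 8) P => lam (C.form v.proj v.snd)) := by
  rw [funext fun v : TangentBundle (𝓡 8) P => linear_apply_eq_sum lam (C.form v.proj v.snd)]
  exact contMDiff_finsetSum fun i _ => contMDiff_finsetSum fun j _ =>
    contMDiff_const.mul (C.contMDiff_form i j)

/-- The vector field `ω_I⁻¹(x)`. -/
def field (x : g) (z : P) : TangentSpace (𝓡 8) z := (C.formI z).symm x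

lemma formI_field (x : g) (z : P) : C.formI z (C.field x z) = x :=
  (C.formI z).apply_symm_apply x

lemma form_field (x : g) (z : P) : C.form z (C.field x z) = ad x.1 + C.χ z x := by
  rw [form_eq, formI_field]

lemma isSmoothField_field (x : g) : IsSmoothField (C.field x) := by
  let κ : Fin 8 → Mat8 →ₗ[ℝ] ℝ := fun a =>
    { toFun := fun X => coords (prG X).1 a
      map_add' := fun X Y => by
        rw [map_add]
        exact congrFun (coords_add _ _) a
      map_smul' := fun c X => by
        rw [map_smul]
        exact congrFun (coords_smul _ _) a }
  refine isSmoothField_of_coframe (fun a z => κ a ∘ₗ C.form z)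
    (fun a => C.contMDiff_linear_form (κ a)) ?_ _ (coords x.1) ?_
  · intro z v h
    have h' : ∀ a, coords (C.formI z v).1 a = 0 := h
    refine (C.formI z).map_eq_zero_iff.1 (Subtype.ext ?_)
    rw [← sum_coords_smul_A]
    simp [h']
  · intro z a
    change coords (C.formI z (C.field x z)).1 a = _
    rw [formI_field]

lemma contMDiff_linear_form_field (lam : Mat8 →ₗ[ℝ] ℝ) (x : g) : ContMDiff (𝓡 8) 𝓘(ℝ, ℝ) ∞
    (fun z => lam (C.form z (C.field x z))) :=
  (C.contMDiff_linear_form lam).comp (C.isSmoothField_field x)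

lemma coord_eq (j : Fin 3) (K : Fin 20) (z : P) :
    C.coord j K z = coef K (C.form z (C.field (e j) z)) := by
  rw [form_field, map_add, coef_ad, zero_add, coord]

lemma contMDiff_coord (j : Fin 3) (K : Fin 20) : ContMDiff (𝓡 8) 𝓘(ℝ, ℝ) ∞ (C.coord j K) := by
  rw [funext (C.coord_eq j K)]
  exact C.contMDiff_linear_form_field (coef K) (e j)

/-! ### The structure equation -/

lemma D_eq (x : g) (f : P → ℝ) : C.D x f = derivAlong (C.field x) f := rfl

lemma derivAlong_linear_form_field (lam : Mat8 →ₗ[ℝ] ℝ) (X : ∀ z : P, TangentSpace (𝓡 8) z) (x : g)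
    (z : P) : derivAlong X (fun w => lam (C.form w (C.field x w))) z =
      ∑ i, ∑ j, lam (Matrix.single i j 1) *
        derivAlong X (fun w => C.form w (C.field x w) i j) z := by
  have h : ∀ i j, ContMDiff (𝓡 8) 𝓘(ℝ, ℝ) ∞ (fun w => C.form w (C.field x w) i j) := fun i j =>
    (C.contMDiff_form i j).comp (C.isSmoothField_field x)
  rw [funext fun w => linear_apply_eq_sum lam (C.form w (C.field x w))]
  exact derivAlong_sum_sum_mul X _ _ (fun i j => lam (Matrix.single i j 1)) h z

lemma structure_eq_linear (lam : Mat8 →ₗ[ℝ] ℝ) (x y : g) (z : P) :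
    C.D x (fun w => lam (C.form w (C.field y w))) z -
      C.D y (fun w => lam (C.form w (C.field x w))) z -
      lam (C.form z (VectorField.mlieBracket (𝓡 8) (C.field x) (C.field y) z)) +
      lam ⁅C.form z (C.field x z), C.form z (C.field y z)⁆ = 0 := by
  have h := C.structure_eq _ _ (C.isSmoothField_field x) (C.isSmoothField_field y) z
  rw [D_eq, D_eq, derivAlong_linear_form_field, derivAlong_linear_form_field,
    linear_apply_eq_sum lam (C.form z _), linear_apply_eq_sum lam ⁅_, _⁆]
  simp only [← Finset.sum_sub_distrib, ← Finset.sum_add_distrib]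
  refine Finset.sum_eq_zero fun i _ => Finset.sum_eq_zero fun j _ => ?_
  rw [← mul_sub, ← mul_sub, ← mul_add, h, mul_zero]

/-- The unknown bracket of the two fields is eliminated: its `ω_I` is the `𝔤`-component of the
bracket of the values of `ω`, and its `ω_II` is `χ` of that. -/
lemma structure_eq_coord (i j : Fin 3) (K : Fin 20) (z : P) :
    C.D (e i) (C.coord j K) z - C.D (e j) (C.coord i K) z -
      ∑ m, eStar m (prG ⁅ad (e i).1 + perpSum (fun K => C.coord i K z),
        ad (e j).1 + perpSum (fun K => C.coord j K z)⁆) * C.coord m K z +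
      coef K ⁅ad (e i).1 + perpSum (fun K => C.coord i K z),
        ad (e j).1 + perpSum (fun K => C.coord j K z)⁆ = 0 := by
  have h1 := C.structure_eq_linear (coef K) (e i) (e j) z
  simp only [← coord_eq] at h1
  rw [form_field, form_field, χ_e, χ_e] at h1
  have h2 : ∀ m, eStar m (prG ⁅ad (e i).1 + perpSum (fun K => C.coord i K z),
      ad (e j).1 + perpSum (fun K => C.coord j K z)⁆) =
      eStar m (C.formI z (VectorField.mlieBracket (𝓡 8) (C.field (e i)) (C.field (e j)) z)) := by
    intro m
    -- With this functional the two derivative terms vanish, because `ω_I` is constant along the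
    -- fields.
    have h := C.structure_eq_linear (eStar m ∘ₗ prG) (e i) (e j) z
    have h' : ∀ x : g, (fun w => (eStar m ∘ₗ prG) (C.form w (C.field x w))) = fun _ => eStar m x :=
      fun x => funext fun w => congrArg (eStar m) (C.formI_field x w)
    rw [h', h', D_eq, D_eq, derivAlong_const, derivAlong_const, form_field, form_field, χ_e,
      χ_e] at h
    simp only [LinearMap.comp_apply, ← formI_apply] at h ⊢
    linarith
  have h3 : coef K (C.form z (VectorField.mlieBracket (𝓡 8) (C.field (e i)) (C.field (e j)) z)) =
      ∑ m, eStar m (C.formI z (VectorField.mlieBracket (𝓡 8) (C.field (e i)) (C.field (e j)) z)) *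
        C.coord m K z := by
    rw [form_eq, map_add, coef_ad, zero_add, χ_apply]
    simp [coord]
  simp only [h2, ← h3]
  exact h1

end ExtrinsicCartanConnection

/-! ### Homogeneous parts in coordinates -/

lemma degPart_perpSum (d : ℤ) (x : Fin 20 → ℝ) :
    degPart d (perpSum x) = perpSum fun K => if degPerp K = d then x K else 0 := by
  have h : ∀ K, (if degPerp K = d then x K else 0) • perp K = x K • degPart d (perp K) := fun K => by
    rw [degPart_perp]
    split_ifs <;> simp
  simp only [perpSum, h]
  ext a b
  simp only [degPart, Matrix.of_apply, Matrix.sum_apply, Matrix.smul_apply, smul_eq_mul]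
  split_ifs <;> simp

lemma homPart_e (p : ℤ) (f : g →ₗ[ℝ] Mat8) (j : Fin 3) :
    homPart p f (e j) = degPart (p + degE j) (f (e j)) := by
  simp [homPart, tens, LinearMap.sum_apply, eStar_e]

namespace ExtrinsicCartanConnection

variable {M P : Type*}
  [TopologicalSpace M] [ChartedSpace (EuclideanSpace ℝ (Fin 3)) M]
  [TopologicalSpace P] [ChartedSpace (EuclideanSpace ℝ (Fin 8)) P]
  [IsManifold (𝓡 8) ∞ P] {C : ExtrinsicCartanConnection M P}

/-! ### Normal connections -/

lemma IsNormal.coord_eq_zero (hC : C.IsNormal) (j : Fin 3) (K : Fin 20)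
    (h : degPerp K - degE j ≤ 0) (z : P) : C.coord j K z = 0 := by
  have h1 := congrArg (fun f => coef K (f (e j))) (hC.2 z _ h)
  simp only [homPart_e, sub_add_cancel, χ_e, degPart_perpSum, coef_perpSum, if_true,
    LinearMap.zero_apply, map_zero] at h1
  exact h1

lemma IsNormal.codiff_eq (hC : C.IsNormal) (K : Fin 20) (z : P) :
    ∑ i, (eCheckBackScal i K / 6 : ℝ) * C.coord i (eCheckBack i K) z = 0 := by
  have h1 := congrArg (coef K) (hC.1 z)
  simpa only [codiff, χ_e, map_sum, coef_lie_eCheck_perpSum, map_zero] using h1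

variable (C) in
/-- The coordinates of `χ` of degree less than `p` vanish outside of the allowed positions. -/
def VanishBelow (p : ℤ) : Prop :=
  ∀ j K, degPerp K - degE j < p → ¬ Allowed j K → ∀ z, C.coord j K z = 0

lemma IsNormal.vanishBelow_one (hC : C.IsNormal) : C.VanishBelow 1 :=
  fun j K h _ => hC.coord_eq_zero j K (by omega)

lemma VanishBelow.succ {p : ℤ} (hV : C.VanishBelow p)
    (h : ∀ j K, degPerp K - degE j = p → ¬ Allowed j K → ∀ z, C.coord j K z = 0) :
    C.VanishBelow (p + 1) := fun j K hK hA =>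
  (lt_or_eq_of_le (Int.lt_add_one_iff.1 hK)).elim (fun h1 => hV j K h1 hA) fun h1 => h j K h1 hA

lemma D_eq_zero (x : g) {f : P → ℝ} (hf : ∀ z, f z = 0) (z : P) : C.D x f z = 0 := by
  rw [funext hf, D_eq]
  exact derivAlong_const _ 0 z

lemma D_const_mul (x : g) (c : ℝ) {f : P → ℝ} (hf : ContMDiff (𝓡 8) 𝓘(ℝ, ℝ) ∞ f) :
    C.D x (fun w => c * f w) = fun z => c * C.D x f z :=
  funext fun z => derivAlong_const_mul _ c hf z

section Linear

variable {p : ℤ} (hV : C.VanishBelow p) (hC : C.IsNormal) (i j : Fin 3) (K : Fin 20)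
  (hp : p ≤ 5) (hij : i ≠ j) (hK : degPerp K - degE i - degE j = p) (z : P)

include hV hC hp hij hK

lemma VanishBelow.linear_eq : C.D (e i) (C.coord j K) z - C.D (e j) (C.coord i K) z -
    lieScal i j * C.coord 0 K z + eBackScal i K / 6 * C.coord j (eBack i K) z -
      eBackScal j K / 6 * C.coord i (eBack j K) z = 0 :=
  linear_structure_eq (x := fun j K => C.coord j K z)
    (d := fun i j K => C.D (e i) (C.coord j K) z)
    (fun j K h => hC.coord_eq_zero j K h z) (fun j K h hA => hV j K h hA z) hp hij hK
    (C.structure_eq_coord i j K z)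

lemma VanishBelow.linear_eq_of_not_allowed (hi : ¬ Allowed i K) :
    C.D (e i) (C.coord j K) z - lieScal i j * C.coord 0 K z +
      eBackScal i K / 6 * C.coord j (eBack i K) z -
      eBackScal j K / 6 * C.coord i (eBack j K) z = 0 := by
  have h := hV.linear_eq hC i j K hp hij hK z
  have hj : degE j < 0 := (by decide : ∀ m, degE m < 0) j
  rwa [D_eq_zero _ (hV i K (by omega) hi), sub_zero] at h

/-- Differentiated coordinates have degree `p + degE i` or `p + degE j`, less than `p`. Outside the
allowed positions they vanish identically, hence so do their derivatives. -/
lemma VanishBelow.algebraic_eq (hi : ¬ Allowed i K) (hj : ¬ Allowed j K) :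
    - (lieScal i j * C.coord 0 K z) + eBackScal i K / 6 * C.coord j (eBack i K) z -
      eBackScal j K / 6 * C.coord i (eBack j K) z = 0 := by
  have h := hV.linear_eq_of_not_allowed hC i j K hp hij hK z hi
  have hi' : degE i < 0 := (by decide : ∀ m, degE m < 0) i
  rwa [D_eq_zero _ (hV j K (by omega) hj), zero_sub] at h

end Linear

/-- The harmonic equations in degree 1: the listed derivative-free components of the structure
equation (`a`) and of `∂*χ = 0` (`b`) force all ten other coordinates to vanish. Degrees 2 and 3 are
treated in the same way. -/
lemma IsNormal.vanishBelow_two (hC : C.IsNormal) : C.VanishBelow 2 := by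
  have hV : C.VanishBelow 1 := hC.vanishBelow_one
  refine hV.succ fun j K hK hA z => ?_
  have hjK : ∀ j K, degPerp K - degE j = 1 → ¬ Allowed j K →
      j = 0 ∧ K = 5 ∨ j = 0 ∧ K = 7 ∨ j = 1 ∧ K = 4 ∨ j = 1 ∧ K = 6 ∨ j = 2 ∧ K = 4 ∨ j = 0 ∧ K = 12 ∨ j = 0 ∧ K = 13 ∨ j = 1 ∧ K = 14 ∨ j = 2 ∧ K = 14 ∨ j = 2 ∧ K = 16 := by
    decide +kernel
  have a1 := hV.algebraic_eq hC 0 1 8 (by decide) (by decide) (by decide) z (by decide) (by decide)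
  have a2 := hV.algebraic_eq hC 0 2 8 (by decide) (by decide) (by decide) z (by decide) (by decide)
  have a3 := hV.algebraic_eq hC 1 2 5 (by decide) (by decide) (by decide) z (by decide) (by decide)
  have a4 := hV.algebraic_eq hC 1 2 7 (by decide) (by decide) (by decide) z (by decide) (by decide)
  have a5 := hV.algebraic_eq hC 0 1 11 (by decide) (by decide) (by decide) z (by decide) (by decide)
  have a6 := hV.algebraic_eq hC 0 2 11 (by decide) (by decide) (by decide) z (by decide) (by decide)
  have a7 := hV.algebraic_eq hC 1 2 12 (by decide) (by decide) (by decide) z (by decide) (by decide)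
  have a8 := hV.algebraic_eq hC 1 2 13 (by decide) (by decide) (by decide) z (by decide) (by decide)
  have b1 := hC.codiff_eq 2 z
  have b2 := hC.codiff_eq 3 z
  have b3 := hC.codiff_eq 15 z
  have b4 := hC.codiff_eq 17 z
  simp [Fin.sum_univ_three, lieScal, eBackScal, eBack, eCheckBackScal, eCheckBack] at a1 a2 a3 a4 a5 a6 a7 a8 b1 b2 b3 b4
  obtain ⟨rfl, rfl⟩ | ⟨rfl, rfl⟩ | ⟨rfl, rfl⟩ | ⟨rfl, rfl⟩ | ⟨rfl, rfl⟩ | ⟨rfl, rfl⟩ | ⟨rfl, rfl⟩ | ⟨rfl, rfl⟩ | ⟨rfl, rfl⟩ | ⟨rfl, rfl⟩ := hjK j K hK hA <;> linarith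

lemma IsNormal.vanishBelow_three (hC : C.IsNormal) : C.VanishBelow 3 := by
  have hV : C.VanishBelow 2 := hC.vanishBelow_two
  refine hV.succ fun j K hK hA z => ?_
  have hjK : ∀ j K, degPerp K - degE j = 2 → ¬ Allowed j K →
      j = 0 ∧ K = 4 ∨ j = 1 ∧ K = 2 ∨ j = 1 ∧ K = 3 ∨ j = 2 ∧ K = 2 ∨ j = 0 ∧ K = 14 ∨ j = 1 ∧ K = 15 ∨ j = 2 ∧ K = 15 ∨ j = 2 ∧ K = 17 := by
    decide +kernel
  have a1 := hV.algebraic_eq hC 0 1 5 (by decide) (by decide) (by decide) z (by decide) (by decide)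
  have a2 := hV.algebraic_eq hC 0 1 7 (by decide) (by decide) (by decide) z (by decide) (by decide)
  have a3 := hV.algebraic_eq hC 0 2 5 (by decide) (by decide) (by decide) z (by decide) (by decide)
  have a4 := hV.algebraic_eq hC 1 2 4 (by decide) (by decide) (by decide) z (by decide) (by decide)
  have a5 := hV.algebraic_eq hC 0 1 12 (by decide) (by decide) (by decide) z (by decide) (by decide)
  have a6 := hV.algebraic_eq hC 0 2 12 (by decide) (by decide) (by decide) z (by decide) (by decide)
  have a7 := hV.algebraic_eq hC 0 2 13 (by decide) (by decide) (by decide) z (by decide) (by decide)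
  have a8 := hV.algebraic_eq hC 1 2 14 (by decide) (by decide) (by decide) z (by decide) (by decide)
  have b1 := hC.codiff_eq 1 z
  have b2 := hC.codiff_eq 18 z
  simp [Fin.sum_univ_three, lieScal, eBackScal, eBack, eCheckBackScal, eCheckBack] at a1 a2 a3 a4 a5 a6 a7 a8 b1 b2
  obtain ⟨rfl, rfl⟩ | ⟨rfl, rfl⟩ | ⟨rfl, rfl⟩ | ⟨rfl, rfl⟩ | ⟨rfl, rfl⟩ | ⟨rfl, rfl⟩ | ⟨rfl, rfl⟩ | ⟨rfl, rfl⟩ := hjK j K hK hA <;> linarith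

lemma IsNormal.vanishBelow_four (hC : C.IsNormal) : C.VanishBelow 4 := by
  have hV : C.VanishBelow 3 := hC.vanishBelow_three
  refine hV.succ fun j K hK hA z => ?_
  have hjK : ∀ j K, degPerp K - degE j = 3 → ¬ Allowed j K →
      j = 0 ∧ K = 2 ∨ j = 1 ∧ K = 1 ∨ j = 0 ∧ K = 15 ∨ j = 2 ∧ K = 18 := by
    decide +kernel
  have a1 := hV.algebraic_eq hC 0 1 4 (by decide) (by decide) (by decide) z (by decide) (by decide)
  have a2 := hV.algebraic_eq hC 0 2 14 (by decide) (by decide) (by decide) z (by decide) (by decide)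
  have b1 := hC.codiff_eq 0 z
  have b2 := hC.codiff_eq 19 z
  simp [Fin.sum_univ_three, lieScal, eBackScal, eBack, eCheckBackScal, eCheckBack] at a1 a2 b1 b2
  obtain ⟨rfl, rfl⟩ | ⟨rfl, rfl⟩ | ⟨rfl, rfl⟩ | ⟨rfl, rfl⟩ := hjK j K hK hA <;> linarith

/-- The condition `∂*χ = 0` contributes nothing here, as `𝔤^⊥` has no part of degree 4. -/
lemma IsNormal.vanishBelow_five (hC : C.IsNormal) : C.VanishBelow 5 := by
  have hV : C.VanishBelow 4 := hC.vanishBelow_four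
  refine hV.succ fun j K hK hA z => ?_
  have hjK : ∀ j K, degPerp K - degE j = 4 → ¬ Allowed j K →
      j = 1 ∧ K = 0 ∨ j = 2 ∧ K = 19 := by
    decide +kernel
  have a1 := hV.algebraic_eq hC 0 1 2 (by decide) (by decide) (by decide) z (by decide) (by decide)
  have a2 := hV.algebraic_eq hC 0 2 15 (by decide) (by decide) (by decide) z (by decide) (by decide)
  simp [lieScal, eBackScal, eBack] at a1 a2
  obtain ⟨rfl, rfl⟩ | ⟨rfl, rfl⟩ := hjK j K hK hA <;> linarith

lemma IsNormal.coord_eq_zero_of_not_allowed (hC : C.IsNormal) (j : Fin 3) (K : Fin 20)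
    (h : ¬ Allowed j K) (z : P) : C.coord j K z = 0 := by
  -- The top degree `3 + 2 = 5` is attained only by `R_{2,1} ⊗ e₀*` and `S_{1,2} ⊗ e₀*`, both
  -- allowed.
  have hV : C.VanishBelow (5 + 1) := hC.vanishBelow_five.succ fun j K hK hA =>
    absurd hK ((by decide +kernel : ∀ j K, ¬ Allowed j K → degPerp K - degE j ≠ 5) j K hA)
  exact hV j K ((by decide +kernel : ∀ j K, degPerp K - degE j < 5 + 1) j K) h z

/-! ### The remaining coordinates of a normal connection -/

/-- Two equations for two unknowns: `a` is derivative-free and fixes the ratio of the coordinates at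
`e₂` and `e₀`, while `b` equates their sum with `-D_{e₁} h`. The next degree follows the same
pattern. -/
lemma IsNormal.coord_R_two (hC : C.IsNormal) :
    C.coord 2 3 = (fun z => -(3 / 4) * (C.D (e 1))^[1] (C.coord 2 6) z) ∧
      C.coord 0 6 = (fun z => -(1 / 4) * (C.D (e 1))^[1] (C.coord 2 6) z) := by
  have key : ∀ z, C.coord 2 3 z = -(3 / 4) * (C.D (e 1))^[1] (C.coord 2 6) z ∧
      C.coord 0 6 z = -(1 / 4) * (C.D (e 1))^[1] (C.coord 2 6) z := by
    intro z
    have a := hC.vanishBelow_two.algebraic_eq hC 0 2 7 (by decide) (by decide) (by decide) z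
      (by decide) (by decide)
    have b := hC.vanishBelow_two.linear_eq_of_not_allowed hC 1 2 6 (by decide) (by decide) (by decide) z
      (by decide)
    simp [lieScal, eBackScal, eBack] at a b
    simp only [Function.iterate_succ_apply', Function.iterate_zero, id_eq] at b ⊢
    constructor <;> linarith
  exact ⟨funext fun z => (key z).1, funext fun z => (key z).2⟩

lemma IsNormal.contMDiff_R_two (hC : C.IsNormal) :
    ContMDiff (𝓡 8) 𝓘(ℝ, ℝ) ∞ ((C.D (e 1))^[1] (C.coord 2 6)) :=
  contMDiff_of_const_mul (by norm_num) (C.contMDiff_coord 2 3) hC.coord_R_two.1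

lemma IsNormal.coord_R_three (hC : C.IsNormal) :
    C.coord 2 1 = (fun z => 1 / 2 * (C.D (e 1))^[2] (C.coord 2 6) z) ∧
      C.coord 0 3 = (fun z => 1 / 4 * (C.D (e 1))^[2] (C.coord 2 6) z) := by
  have key : ∀ z, C.coord 2 1 z = 1 / 2 * (C.D (e 1))^[2] (C.coord 2 6) z ∧
      C.coord 0 3 z = 1 / 4 * (C.D (e 1))^[2] (C.coord 2 6) z := by
    intro z
    have a := hC.vanishBelow_three.algebraic_eq hC 0 2 4 (by decide) (by decide) (by decide) z
      (by decide) (by decide)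
    have b := hC.vanishBelow_three.linear_eq_of_not_allowed hC 1 2 3 (by decide) (by decide) (by decide) z
      (by decide)
    rw [hC.coord_R_two.1, D_const_mul _ _ hC.contMDiff_R_two, ← Function.iterate_succ_apply' (C.D (e 1))] at b
    simp [lieScal, eBackScal, eBack] at a b
    simp only [Function.iterate_succ_apply', Function.iterate_zero, id_eq] at b ⊢
    constructor <;> linarith
  exact ⟨funext fun z => (key z).1, funext fun z => (key z).2⟩

lemma IsNormal.contMDiff_R_three (hC : C.IsNormal) :
    ContMDiff (𝓡 8) 𝓘(ℝ, ℝ) ∞ ((C.D (e 1))^[2] (C.coord 2 6)) :=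
  contMDiff_of_const_mul (by norm_num) (C.contMDiff_coord 2 1) hC.coord_R_three.1

/-- Now `b` is taken at `e₁, e₀`, where it contains only one undifferentiated coordinate, the one at
`e₀`; `a` says that the coordinate at `e₂` equals it. -/
lemma IsNormal.coord_R_four (hC : C.IsNormal) :
    C.coord 2 0 = (fun z => -(1 / 4) * (C.D (e 1))^[3] (C.coord 2 6) z) ∧
      C.coord 0 1 = (fun z => -(1 / 4) * (C.D (e 1))^[3] (C.coord 2 6) z) := by
  have key : ∀ z, C.coord 2 0 z = -(1 / 4) * (C.D (e 1))^[3] (C.coord 2 6) z ∧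
      C.coord 0 1 z = -(1 / 4) * (C.D (e 1))^[3] (C.coord 2 6) z := by
    intro z
    have a := hC.vanishBelow_four.algebraic_eq hC 0 2 2 (by decide) (by decide) (by decide) z
      (by decide) (by decide)
    have b := hC.vanishBelow_four.linear_eq_of_not_allowed hC 1 0 3 (by decide) (by decide) (by decide) z
      (by decide)
    rw [hC.coord_R_three.2, D_const_mul _ _ hC.contMDiff_R_three, ← Function.iterate_succ_apply' (C.D (e 1))] at b
    simp [lieScal, eBackScal, eBack] at a b
    simp only [Function.iterate_succ_apply', Function.iterate_zero, id_eq] at b ⊢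
    constructor <;> linarith
  exact ⟨funext fun z => (key z).1, funext fun z => (key z).2⟩

lemma IsNormal.contMDiff_R_four (hC : C.IsNormal) :
    ContMDiff (𝓡 8) 𝓘(ℝ, ℝ) ∞ ((C.D (e 1))^[3] (C.coord 2 6)) :=
  contMDiff_of_const_mul (by norm_num) (C.contMDiff_coord 2 0) hC.coord_R_four.1

lemma IsNormal.coord_R_five (hC : C.IsNormal) :
    C.coord 0 0 = (fun z => 1 / 4 * (C.D (e 1))^[4] (C.coord 2 6) z) := by
  have key : ∀ z, C.coord 0 0 z = 1 / 4 * (C.D (e 1))^[4] (C.coord 2 6) z := by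
    intro z
    have b := hC.vanishBelow_five.linear_eq_of_not_allowed hC 1 0 1 (by decide) (by decide) (by decide) z
      (by decide)
    rw [hC.coord_R_four.2, D_const_mul _ _ hC.contMDiff_R_four, ← Function.iterate_succ_apply' (C.D (e 1))] at b
    simp [lieScal, eBackScal, eBack] at b
    simp only [Function.iterate_succ_apply', Function.iterate_zero, id_eq] at b ⊢
    linarith
  exact funext key

/-- The `S`-case mirrors the `R`-case with `e₁` and `e₂` exchanged. The sign of the `e₀` coordinate
changes because `[e₁, e₂] = -e₀` while `[e₂, e₁] = e₀`. -/
lemma IsNormal.coord_S_two (hC : C.IsNormal) :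
    C.coord 1 17 = (fun z => -(3 / 4) * (C.D (e 2))^[1] (C.coord 1 16) z) ∧
      C.coord 0 16 = (fun z => 1 / 4 * (C.D (e 2))^[1] (C.coord 1 16) z) := by
  have key : ∀ z, C.coord 1 17 z = -(3 / 4) * (C.D (e 2))^[1] (C.coord 1 16) z ∧
      C.coord 0 16 z = 1 / 4 * (C.D (e 2))^[1] (C.coord 1 16) z := by
    intro z
    have a := hC.vanishBelow_two.algebraic_eq hC 0 1 13 (by decide) (by decide) (by decide) z
      (by decide) (by decide)
    have b := hC.vanishBelow_two.linear_eq_of_not_allowed hC 2 1 16 (by decide) (by decide) (by decide) z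
      (by decide)
    simp [lieScal, eBackScal, eBack] at a b
    simp only [Function.iterate_succ_apply', Function.iterate_zero, id_eq] at b ⊢
    constructor <;> linarith
  exact ⟨funext fun z => (key z).1, funext fun z => (key z).2⟩

lemma IsNormal.contMDiff_S_two (hC : C.IsNormal) :
    ContMDiff (𝓡 8) 𝓘(ℝ, ℝ) ∞ ((C.D (e 2))^[1] (C.coord 1 16)) :=
  contMDiff_of_const_mul (by norm_num) (C.contMDiff_coord 1 17) hC.coord_S_two.1

lemma IsNormal.coord_S_three (hC : C.IsNormal) :
    C.coord 1 18 = (fun z => 1 / 2 * (C.D (e 2))^[2] (C.coord 1 16) z) ∧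
      C.coord 0 17 = (fun z => -(1 / 4) * (C.D (e 2))^[2] (C.coord 1 16) z) := by
  have key : ∀ z, C.coord 1 18 z = 1 / 2 * (C.D (e 2))^[2] (C.coord 1 16) z ∧
      C.coord 0 17 z = -(1 / 4) * (C.D (e 2))^[2] (C.coord 1 16) z := by
    intro z
    have a := hC.vanishBelow_three.algebraic_eq hC 0 1 14 (by decide) (by decide) (by decide) z
      (by decide) (by decide)
    have b := hC.vanishBelow_three.linear_eq_of_not_allowed hC 2 1 17 (by decide) (by decide) (by decide) z
      (by decide)
    rw [hC.coord_S_two.1, D_const_mul _ _ hC.contMDiff_S_two, ← Function.iterate_succ_apply' (C.D (e 2))] at b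
    simp [lieScal, eBackScal, eBack] at a b
    simp only [Function.iterate_succ_apply', Function.iterate_zero, id_eq] at b ⊢
    constructor <;> linarith
  exact ⟨funext fun z => (key z).1, funext fun z => (key z).2⟩

lemma IsNormal.contMDiff_S_three (hC : C.IsNormal) :
    ContMDiff (𝓡 8) 𝓘(ℝ, ℝ) ∞ ((C.D (e 2))^[2] (C.coord 1 16)) :=
  contMDiff_of_const_mul (by norm_num) (C.contMDiff_coord 1 18) hC.coord_S_three.1

lemma IsNormal.coord_S_four (hC : C.IsNormal) :
    C.coord 1 19 = (fun z => -(1 / 4) * (C.D (e 2))^[3] (C.coord 1 16) z) ∧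
      C.coord 0 18 = (fun z => 1 / 4 * (C.D (e 2))^[3] (C.coord 1 16) z) := by
  have key : ∀ z, C.coord 1 19 z = -(1 / 4) * (C.D (e 2))^[3] (C.coord 1 16) z ∧
      C.coord 0 18 z = 1 / 4 * (C.D (e 2))^[3] (C.coord 1 16) z := by
    intro z
    have a := hC.vanishBelow_four.algebraic_eq hC 0 1 15 (by decide) (by decide) (by decide) z
      (by decide) (by decide)
    have b := hC.vanishBelow_four.linear_eq_of_not_allowed hC 2 0 17 (by decide) (by decide) (by decide) z
      (by decide)
    rw [hC.coord_S_three.2, D_const_mul _ _ hC.contMDiff_S_three, ← Function.iterate_succ_apply' (C.D (e 2))] at b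
    simp [lieScal, eBackScal, eBack] at a b
    simp only [Function.iterate_succ_apply', Function.iterate_zero, id_eq] at b ⊢
    constructor <;> linarith
  exact ⟨funext fun z => (key z).1, funext fun z => (key z).2⟩

lemma IsNormal.contMDiff_S_four (hC : C.IsNormal) :
    ContMDiff (𝓡 8) 𝓘(ℝ, ℝ) ∞ ((C.D (e 2))^[3] (C.coord 1 16)) :=
  contMDiff_of_const_mul (by norm_num) (C.contMDiff_coord 1 19) hC.coord_S_four.1

lemma IsNormal.coord_S_five (hC : C.IsNormal) :
    C.coord 0 19 = (fun z => -(1 / 4) * (C.D (e 2))^[4] (C.coord 1 16) z) := by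
  have key : ∀ z, C.coord 0 19 z = -(1 / 4) * (C.D (e 2))^[4] (C.coord 1 16) z := by
    intro z
    have b := hC.vanishBelow_five.linear_eq_of_not_allowed hC 2 0 18 (by decide) (by decide) (by decide) z
      (by decide)
    rw [hC.coord_S_four.2, D_const_mul _ _ hC.contMDiff_S_four, ← Function.iterate_succ_apply' (C.D (e 2))] at b
    simp [lieScal, eBackScal, eBack] at b
    simp only [Function.iterate_succ_apply', Function.iterate_zero, id_eq] at b ⊢
    linarith
  exact funext key

end ExtrinsicCartanConnection

/-! ### The action of `𝔤₊` on `ξ₁^R` and `ξ₁^S` -/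

lemma tens_smul (c : ℝ) (X : Mat8) (lam : g →ₗ[ℝ] ℝ) : tens (c • X) lam = c • tens X lam := by
  refine LinearMap.ext fun y => ?_
  simp only [tens, LinearMap.smulRight_apply, LinearMap.smul_apply]
  exact smul_comm _ _ _

lemma rho_add (x : g) (f f' : g →ₗ[ℝ] Mat8) : rho x (f + f') = rho x f + rho x f' := by
  refine LinearMap.ext fun y => ?_
  change ⁅ad x.1, f y + f' y⁆ - (f ⁅x, y⁆ + f' ⁅x, y⁆) =
    (⁅ad x.1, f y⁆ - f ⁅x, y⁆) + (⁅ad x.1, f' y⁆ - f' ⁅x, y⁆)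
  rw [lie_add]
  abel

lemma rho_smul (x : g) (c : ℝ) (f : g →ₗ[ℝ] Mat8) : rho x (c • f) = c • rho x f := by
  refine LinearMap.ext fun y => ?_
  change ⁅ad x.1, c • f y⁆ - c • f ⁅x, y⁆ = c • (⁅ad x.1, f y⁆ - f ⁅x, y⁆)
  rw [lie_smul, smul_sub]

/-- The linear form `eStar m ∘ ad (eCheck i)` is the multiple `eStarScal i m` of `eStar 0`. -/
def eStarScal (i m : Fin 3) : ℝ := ![![0, 0, 0], ![0, 0, -1], ![0, 1, 0]] i m

lemma eStar_lie_eCheck (i m : Fin 3) (y : g) :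
    eStar m ⁅eCheck i, y⁆ = eStarScal i m * eStar 0 y := by
  have h : ∀ x : g, eStar m x = x.1 (![2, 1, 2] m) (![0, 0, 1] m) := fun x => rfl
  have h0 : eStar 0 y = y.1 2 0 := rfl
  have h1 : (⁅eCheck i, y⁆ : g).1 = (eCheck i).1 * y.1 - y.1 * (eCheck i).1 := rfl
  rw [h, h0, h1]
  fin_cases i <;> fin_cases m <;>
    simp [eCheck, E, eStarScal, Matrix.mul_apply, Fin.sum_univ_three]

lemma rho_eCheck_tens_perp (i m : Fin 3) (K : Fin 20) :
    rho (eCheck i) (tens (perp K) (eStar m)) =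
      ((eCheckScal i K : ℝ) / 6) • tens (perp (eCheckShift i K)) (eStar m) -
        eStarScal i m • tens (perp K) (eStar 0) := by
  refine LinearMap.ext fun y => ?_
  change ⁅ad (eCheck i).1, eStar m y • perp K⁆ - eStar m ⁅eCheck i, y⁆ • perp K =
    ((eCheckScal i K : ℝ) / 6) • eStar m y • perp (eCheckShift i K) -
      eStarScal i m • eStar 0 y • perp K
  rw [lie_smul, lie_eCheck_perp, eStar_lie_eCheck, smul_comm, mul_smul]

lemma xiR_eq : xiR = tens (perp 6) (eStar 2) := congrArg (tens · _) (perp_castAdd 6).symm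

lemma xiS_eq : xiS = tens (perp 16) (eStar 1) := congrArg (tens · _) (perp_natAdd 6).symm

lemma rho_xiR : rho (eCheck 1) xiR =
    (3 : ℝ) • tens (perp 3) (eStar 2) + tens (perp 6) (eStar 0) := by
  rw [xiR_eq, rho_eCheck_tens_perp]
  simp [eCheckScal, eCheckShift, eStarScal]
  module

lemma rho_two_xiR : (rho (eCheck 1))^[2] xiR =
    (12 : ℝ) • tens (perp 1) (eStar 2) + (6 : ℝ) • tens (perp 3) (eStar 0) := by
  rw [Function.iterate_succ_apply', Function.iterate_one, rho_xiR, rho_add, rho_smul,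
    rho_eCheck_tens_perp, rho_eCheck_tens_perp]
  simp [eCheckScal, eCheckShift, eStarScal]
  module

lemma rho_three_xiR : (rho (eCheck 1))^[3] xiR =
    (36 : ℝ) • tens (perp 0) (eStar 2) + (36 : ℝ) • tens (perp 1) (eStar 0) := by
  rw [Function.iterate_succ_apply', rho_two_xiR, rho_add, rho_smul, rho_smul,
    rho_eCheck_tens_perp, rho_eCheck_tens_perp]
  simp [eCheckScal, eCheckShift, eStarScal]
  module

lemma rho_four_xiR : (rho (eCheck 1))^[4] xiR = (144 : ℝ) • tens (perp 0) (eStar 0) := by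
  rw [Function.iterate_succ_apply', rho_three_xiR, rho_add, rho_smul, rho_smul,
    rho_eCheck_tens_perp, rho_eCheck_tens_perp]
  simp [eCheckScal, eCheckShift, eStarScal]
  module

lemma rho_xiS : rho (eCheck 2) xiS =
    (3 : ℝ) • tens (perp 17) (eStar 1) - tens (perp 16) (eStar 0) := by
  rw [xiS_eq, rho_eCheck_tens_perp]
  simp [eCheckScal, eCheckShift, eStarScal]
  norm_num

lemma rho_two_xiS : (rho (eCheck 2))^[2] xiS =
    (12 : ℝ) • tens (perp 18) (eStar 1) + (-6 : ℝ) • tens (perp 17) (eStar 0) := by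
  rw [Function.iterate_succ_apply', Function.iterate_one, rho_xiS, sub_eq_add_neg, ← neg_one_smul ℝ,
    rho_add, rho_smul, rho_smul, rho_eCheck_tens_perp, rho_eCheck_tens_perp]
  simp [eCheckScal, eCheckShift, eStarScal]
  module

lemma rho_three_xiS : (rho (eCheck 2))^[3] xiS =
    (36 : ℝ) • tens (perp 19) (eStar 1) + (-36 : ℝ) • tens (perp 18) (eStar 0) := by
  rw [Function.iterate_succ_apply', rho_two_xiS, rho_add, rho_smul, rho_smul,
    rho_eCheck_tens_perp, rho_eCheck_tens_perp]
  simp [eCheckScal, eCheckShift, eStarScal]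
  module

lemma rho_four_xiS : (rho (eCheck 2))^[4] xiS = (-144 : ℝ) • tens (perp 19) (eStar 0) := by
  rw [Function.iterate_succ_apply', rho_three_xiS, rho_add, rho_smul, rho_smul,
    rho_eCheck_tens_perp, rho_eCheck_tens_perp]
  simp [eCheckScal, eCheckShift, eStarScal]
  module

/-! ### Homogeneous components -/

lemma projR_perpSum (x : Fin 20 → ℝ) :
    projR (perpSum x) = perpSum fun K => if K < 10 then x K else 0 := by
  have h : ∀ K, projR (perp K) = if K < 10 then perp K else 0 := by
    refine Fin.addCases (m := 10) (n := 10) (fun k => ?_) (fun k => ?_)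
    · rw [perp_castAdd, projR_R, if_pos ((by decide : ∀ k, Fin.castAdd 10 k < (10 : Fin 20)) k)]
    · rw [perp_natAdd, projR_S, if_neg ((by decide : ∀ k, ¬ Fin.natAdd 10 k < (10 : Fin 20)) k)]
  simp [perpSum, h]

lemma projS_perpSum (x : Fin 20 → ℝ) :
    projS (perpSum x) = perpSum fun K => if K < 10 then 0 else x K := by
  have h : ∀ K, projS (perp K) = if K < 10 then 0 else perp K := by
    refine Fin.addCases (m := 10) (n := 10) (fun k => ?_) (fun k => ?_)
    · rw [perp_castAdd, projS_R, if_pos ((by decide : ∀ k, Fin.castAdd 10 k < (10 : Fin 20)) k)]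
    · rw [perp_natAdd, projS_S, if_neg ((by decide : ∀ k, ¬ Fin.natAdd 10 k < (10 : Fin 20)) k)]
  simp [perpSum, h]

/-- In each degree at most one basis vector survives at each `e i`, and `κ` names it. Where none
survives, `κ i` may be any index of the wrong degree, and the conditional discards the term. -/
lemma homPart_eq {p : ℤ} {f : g →ₗ[ℝ] Mat8} {x : Fin 3 → Fin 20 → ℝ}
    (hf : ∀ i, f (e i) = perpSum (x i)) (κ : Fin 3 → Fin 20)
    (hx : ∀ i K, degPerp K = p + degE i → K ≠ κ i → x i K = 0) :
    homPart p f = ∑ i, (if degPerp (κ i) = p + degE i then x i (κ i) else 0) •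
      tens (perp (κ i)) (eStar i) := by
  refine Finset.sum_congr rfl fun i _ => ?_
  rw [hf, degPart_perpSum, perpSum, Finset.sum_eq_single (κ i), tens_smul]
  · intro K _ hK
    split_ifs with h
    · rw [hx i K h hK, zero_smul]
    · exact zero_smul _ _
  · simp

namespace ExtrinsicCartanConnection

variable {M P : Type*}
  [TopologicalSpace M] [ChartedSpace (EuclideanSpace ℝ (Fin 3)) M]
  [TopologicalSpace P] [ChartedSpace (EuclideanSpace ℝ (Fin 8)) P]
  [IsManifold (𝓡 8) ∞ P] {C : ExtrinsicCartanConnection M P}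

lemma IsNormal.χR_eq (hC : C.IsNormal) (p : ℤ) (κ : Fin 3 → Fin 20)
    (hκ : ∀ i K, degPerp K = p + degE i → K < 10 → Allowed i K → K = κ i) (hκ' : ∀ i, κ i < 10)
    (z : P) : C.χR p z = ∑ i, (if degPerp (κ i) = p + degE i then C.coord i (κ i) z else 0) •
      tens (perp (κ i)) (eStar i) := by
  have hf : ∀ i, (projR ∘ₗ C.χ z) (e i) = perpSum fun K => if K < 10 then C.coord i K z else 0 :=
    fun i => by rw [LinearMap.comp_apply, χ_e, projR_perpSum]
  rw [χR, homPart_eq hf κ]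
  · simp only [hκ', if_true]
  · intro i K hK hne
    split_ifs with h
    · exact hC.coord_eq_zero_of_not_allowed i K (fun hA => hne (hκ i K hK h hA)) z
    · rfl

lemma IsNormal.χS_eq (hC : C.IsNormal) (p : ℤ) (κ : Fin 3 → Fin 20)
    (hκ : ∀ i K, degPerp K = p + degE i → ¬ K < 10 → Allowed i K → K = κ i)
    (hκ' : ∀ i, ¬ κ i < 10) (z : P) :
    C.χS p z = ∑ i, (if degPerp (κ i) = p + degE i then C.coord i (κ i) z else 0) •
      tens (perp (κ i)) (eStar i) := by
  have hf : ∀ i, (projS ∘ₗ C.χ z) (e i) = perpSum fun K => if K < 10 then 0 else C.coord i K z :=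
    fun i => by rw [LinearMap.comp_apply, χ_e, projS_perpSum]
  rw [χS, homPart_eq hf κ]
  · simp only [hκ', if_false]
  · intro i K hK hne
    split_ifs with h
    · rfl
    · exact hC.coord_eq_zero_of_not_allowed i K (fun hA => hne (hκ i K hK h hA)) z

lemma IsNormal.χ_eq_sum (hC : C.IsNormal) (z : P) :
    C.χ z = ∑ p ∈ Finset.Icc (1 : ℤ) 5, (C.χR p z + C.χS p z) := by
  have h1 : ∀ p, C.χR p z + C.χS p z = homPart p (C.χ z) := by
    intro p
    rw [χR, χS, homPart, homPart, homPart, ← Finset.sum_add_distrib]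
    refine Finset.sum_congr rfl fun i _ => ?_
    rw [LinearMap.comp_apply, LinearMap.comp_apply, χ_e, projR_perpSum, projS_perpSum,
      degPart_perpSum, degPart_perpSum, degPart_perpSum]
    refine LinearMap.ext fun y => ?_
    simp only [tens, LinearMap.add_apply, LinearMap.smulRight_apply, ← smul_add, perpSum,
      ← Finset.sum_add_distrib, ← add_smul]
    congr 1
    refine Finset.sum_congr rfl fun K _ => ?_
    congr 1
    split_ifs <;> simp
  simp only [h1, homPart]
  rw [Finset.sum_comm]
  refine LinearMap.ext fun y => ?_
  rw [χ_apply]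
  simp only [LinearMap.sum_apply, tens, LinearMap.smulRight_apply, ← Finset.smul_sum, χ_e,
    degPart_perpSum]
  refine Finset.sum_congr rfl fun i _ => ?_
  congr 1
  simp only [perpSum]
  rw [Finset.sum_comm]
  refine Finset.sum_congr rfl fun K _ => ?_
  rw [← Finset.sum_smul]
  congr 1
  -- Each coordinate occurs for exactly one `p`. That value is at most 5, and if it is not positive,
  -- normality makes the coordinate zero.
  have h2 : ∀ p : ℤ, degPerp K = p + degE i ↔ p = degPerp K - degE i := fun p => by omega
  simp only [h2, Finset.sum_ite_eq']
  split_ifs with h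
  · rfl
  · have h5 : degPerp K - degE i ≤ 5 :=
      (by decide +kernel : ∀ i K, degPerp K - degE i ≤ 5) i K
    refine hC.coord_eq_zero i K ?_ z
    by_contra h'
    exact h (Finset.mem_Icc.2 ⟨by omega, h5⟩)

end ExtrinsicCartanConnection

end SL3

end

theorem mainTheorem3 {M P : Type*}
    [TopologicalSpace M] [T2Space M] [SecondCountableTopology M]
    [ChartedSpace (EuclideanSpace ℝ (Fin 3)) M] [IsManifold (𝓡 3) ∞ M]
    [TopologicalSpace P] [T2Space P] [SecondCountableTopology P]
    [ChartedSpace (EuclideanSpace ℝ (Fin 8)) P] [IsManifold (𝓡 8) ∞ P]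
    (C : ExtrinsicCartanConnection M P) (hC : C.IsNormal) :
    ∃ hR hS : P → ℝ, ContMDiff (𝓡 8) 𝓘(ℝ, ℝ) ∞ hR ∧ ContMDiff (𝓡 8) 𝓘(ℝ, ℝ) ∞ hS ∧
      ∀ z : P,
        C.χ z = ∑ p ∈ Finset.Icc (1 : ℤ) 5, (C.χR p z + C.χS p z) ∧
        (C.χR 1 z = hR z • tens R_m1_1 (eStar 2) ∧ C.χR 1 z = hR z • xiR) ∧
        (C.χR 2 z = C.D (e 1) hR z •
            (-(3 / 4 : ℝ) • tens R_0_1 (eStar 2) - (1 / 4 : ℝ) • tens R_m1_1 (eStar 0)) ∧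
          C.χR 2 z = (-(1 / 4) * C.D (e 1) hR z) • rho (eCheck 1) xiR) ∧
        (C.χR 3 z = (C.D (e 1))^[2] hR z •
            ((1 / 2 : ℝ) • tens R_1_1 (eStar 2) + (1 / 4 : ℝ) • tens R_0_1 (eStar 0)) ∧
          C.χR 3 z = (1 / 24 * (C.D (e 1))^[2] hR z) • (rho (eCheck 1))^[2] xiR) ∧
        (C.χR 4 z = (C.D (e 1))^[3] hR z •
            (-(1 / 4 : ℝ) • tens R_2_1 (eStar 2) - (1 / 4 : ℝ) • tens R_1_1 (eStar 0)) ∧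
          C.χR 4 z = (-(1 / (36 * 4)) * (C.D (e 1))^[3] hR z) • (rho (eCheck 1))^[3] xiR) ∧
        (C.χR 5 z = (C.D (e 1))^[4] hR z • ((1 / 4 : ℝ) • tens R_2_1 (eStar 0)) ∧
          C.χR 5 z = (1 / (36 * 4 * 4) * (C.D (e 1))^[4] hR z) • (rho (eCheck 1))^[4] xiR) ∧
        (C.χS 1 z = hS z • tens S_1_m1 (eStar 1) ∧ C.χS 1 z = hS z • xiS) ∧
        (C.χS 2 z = C.D (e 2) hS z •
            (-(3 / 4 : ℝ) • tens S_1_0 (eStar 1) + (1 / 4 : ℝ) • tens S_1_m1 (eStar 0)) ∧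
          C.χS 2 z = (-(1 / 4) * C.D (e 2) hS z) • rho (eCheck 2) xiS) ∧
        (C.χS 3 z = (C.D (e 2))^[2] hS z •
            ((1 / 2 : ℝ) • tens S_1_1 (eStar 1) - (1 / 4 : ℝ) • tens S_1_0 (eStar 0)) ∧
          C.χS 3 z = (1 / 24 * (C.D (e 2))^[2] hS z) • (rho (eCheck 2))^[2] xiS) ∧
        (C.χS 4 z = (C.D (e 2))^[3] hS z •
            (-(1 / 4 : ℝ) • tens S_1_2 (eStar 1) + (1 / 4 : ℝ) • tens S_1_1 (eStar 0)) ∧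
          C.χS 4 z = (-(1 / (36 * 4)) * (C.D (e 2))^[3] hS z) • (rho (eCheck 2))^[3] xiS) ∧
        (C.χS 5 z = (C.D (e 2))^[4] hS z • (-(1 / 4 : ℝ) • tens S_1_2 (eStar 0)) ∧
          C.χS 5 z = (1 / (36 * 4 * 4) * (C.D (e 2))^[4] hS z) • (rho (eCheck 2))^[4] xiS) := by
  have r3 : R_0_1 = perp 3 := (perp_castAdd 3).symm
  have r1 : R_1_1 = perp 1 := (perp_castAdd 1).symm
  have r0 : R_2_1 = perp 0 := (perp_castAdd 0).symm
  have r6 : R_m1_1 = perp 6 := (perp_castAdd 6).symm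
  have s16 : S_1_m1 = perp 16 := (perp_natAdd 6).symm
  have s17 : S_1_0 = perp 17 := (perp_natAdd 7).symm
  have s18 : S_1_1 = perp 18 := (perp_natAdd 8).symm
  have s19 : S_1_2 = perp 19 := (perp_natAdd 9).symm
  refine ⟨C.coord 2 6, C.coord 1 16, C.contMDiff_coord 2 6, C.contMDiff_coord 1 16, fun z => ?_⟩
  -- The vectors list the surviving index at `e₀, e₁, e₂`, or a filler of the wrong degree. In
  -- degree 4 the filler is 6 (for `S`, 16), since 0 and 19 have there the degree that must be
  -- avoided.
  have R1 := hC.χR_eq 1 ![0, 0, 6] (by decide +kernel) (by decide) z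
  have R2 := hC.χR_eq 2 ![6, 0, 3] (by decide +kernel) (by decide) z
  have R3 := hC.χR_eq 3 ![3, 0, 1] (by decide +kernel) (by decide) z
  have R4 := hC.χR_eq 4 ![1, 6, 0] (by decide +kernel) (by decide) z
  have R5 := hC.χR_eq 5 ![0, 0, 0] (by decide +kernel) (by decide) z
  have S1 := hC.χS_eq 1 ![19, 16, 19] (by decide +kernel) (by decide) z
  have S2 := hC.χS_eq 2 ![16, 17, 19] (by decide +kernel) (by decide) z
  have S3 := hC.χS_eq 3 ![17, 18, 19] (by decide +kernel) (by decide) z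
  have S4 := hC.χS_eq 4 ![18, 19, 16] (by decide +kernel) (by decide) z
  have S5 := hC.χS_eq 5 ![19, 19, 19] (by decide +kernel) (by decide) z
  simp [Fin.sum_univ_three, degPerp, degE] at R1 R2 R3 R4 R5 S1 S2 S3 S4 S5
  rw [hC.coord_R_two.1, hC.coord_R_two.2] at R2
  rw [hC.coord_R_three.1, hC.coord_R_three.2] at R3
  rw [hC.coord_R_four.1, hC.coord_R_four.2] at R4
  rw [hC.coord_R_five] at R5
  rw [hC.coord_S_two.1, hC.coord_S_two.2] at S2
  rw [hC.coord_S_three.1, hC.coord_S_three.2] at S3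
  rw [hC.coord_S_four.1, hC.coord_S_four.2] at S4
  rw [hC.coord_S_five] at S5
  rw [Function.iterate_one] at R2 S2
  rw [rho_two_xiR, rho_three_xiR, rho_four_xiR, rho_xiR, xiR_eq, rho_two_xiS, rho_three_xiS,
    rho_four_xiS, rho_xiS, xiS_eq, r0, r1, r3, r6, s16, s17, s18, s19,
    R1, R2, R3, R4, R5, S1, S2, S3, S4, S5]
  refine ⟨hC.χ_eq_sum z, ⟨rfl, rfl⟩, ⟨?_, ?_⟩, ⟨?_, ?_⟩, ⟨?_, ?_⟩, ⟨?_, ?_⟩, ⟨rfl, rfl⟩, ⟨?_, ?_⟩,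
    ⟨?_, ?_⟩, ⟨?_, ?_⟩, ?_, ?_⟩ <;> module
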